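/- **Setting.** Let $n,m,M,N\in\mathbb N$ with $m\ge 1$, $M\ge 2$, $N\ge 1$, and let $T,\alpha,R,R_*,\lambda>0$. Put $d(m)=2(m+1)+\lfloor n/2\rfloor$. For $r\in\mathbb N$ let $H^r([0,T]\times\mathbb R^n)$ be the Sobolev space of functions whose weak derivatives $D^\gamma$ in $(t,y)$ of order $|\gamma|\le r$ lie in $L^2$, with norm $\|u\|_{H^r}^2=\sum_{|\gamma|\le r}\|D^\gamma u\|_{L^2}^2$; as usual, functions equal almost everywhere are identified. Let $$\mathcal H_m=H^{d(m)}([0,T]\times\mathbb R^n,\mathbb R^{n\times n})\times H^{d(m)}([0,T]\times\mathbb R^n,\mathbb R^n),$$ with $\|(a,b)\|_{\mathcal H_m}^2=\sum_{i,j}\|a_{ij}\|_{H^{d(m)}}^2+\sum_i\|b_i\|_{H^{d(m)}}^2$, and let $\mathcal H^+_{m,R_*}$ be the set of all $(a,b)\in\mathcal H_m$ such that $a(t,y)$ is symmetric positive semidefinite for all $(t,y)\in[0,T]\times\mathbb R^n$ and $\operatorname{supp}(a(t,\cdot),b(t,\cdot))\subseteq\{y:\|y\|\le R_*\}$ for every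 $t\in[0,T]$. For $(a,b)\in\mathcal H_m$ let $$\mathcal L^{a,b}_t\varphi=\frac12\sum_{i,j=1}^n(a+\alpha I)_{ij}(t,\cdot)\frac{\partial^2\varphi}{\partial y_i\partial y_j}+\sum_{i=1}^n b_i(t,\cdot)\frac{\partial\varphi}{\partial y_i},$$ and let $(\mathcal L^{a,b}_t)^*$ be its dual operator, in the sense of distributions. Let $X_{\ell,j}\in\mathbb R^n$ ($1\le\ell\le M$, $1\le j\le N$) be any samples, let $t_\ell=T(\ell-1)/(M-1)$, and let $$\widehat p(t,x)=\sum_{\ell=1}^M c_\ell(t)\,\frac1N\sum_{j=1}^N\rho_R(x-X_{\ell,j}),\qquad \rho_R(x)=R^{n/2}\|x\|^{-n/2}J_{n/2}(2\pi R\|x\|),$$ where $J_{n/2}$ is the Bessel function of the first kind ($\rho_R$ is extended continuously to $x=0$), $c_\ell(t)=e_\ell^\top G^{-1}v(t)$, $v(t)=(K_{m+1}(t,t_1),\dots,K_{m+1}(t,t_M))^\top$, $G=(K_{m+1}(t_j,t_k))_{j,k}$, and $K_{m+1}$ is the Sobolev (Matérn) kernel of smoothness $m+1$ on $\mathbb R$,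 $$K_{m+1}(s,t)=\frac{\sqrt{\pi/2}}{2^m\,m!}\,e^{-|s-t|}\sum_{k=0}^m\frac{(m+k)!}{k!\,(m-k)!\,2^k}\,|s-t|^{m-k}.$$ **Proposition.** The learning problem $$\min_{(a,b)\in\mathcal H^+_{m,R_*}}\ L_\lambda(a,b)=\int_0^T\Big\|\frac{\partial\widehat p}{\partial t}(t,\cdot)-(\mathcal L^{a,b}_t)^*\widehat p(t,\cdot)\Big\|_{L^2(\mathbb R^n)}^2\,\mathrm dt+\lambda\|(a,b)\|_{\mathcal H_m}^2$$ is well posed and has a unique solution: the weak derivative $\partial\widehat p/\partial t$ exists in $L^2([0,T]\times\mathbb R^n)$; for every $(a,b)\in\mathcal H^+_{m,R_*}$ the function $(\mathcal L^{a,b}_t)^*\widehat p$ exists in $L^2([0,T]\times\mathbb R^n)$, so that $L_\lambda(a,b)$ is well defined and finite; and there is exactly one $(\widehat a,\widehat b)\in\mathcal H^+_{m,R_*}$ (up to equality almost everywhere on $[0,T]\times\mathbb R^n$) at which $L_\lambda$ attains its minimum over $\mathcal H^+_{m,R_*}$. -/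

import Mathlib

open MeasureTheory Set
open scoped Distributions

namespace FPLearning

/-- The state space `ℝⁿ` with its Euclidean norm. -/
abbrev State (n : ℕ) : Type := EuclideanSpace ℝ (Fin n)

/-- A point `(t, y)` of space-time. -/
abbrev SpaceTime (n : ℕ) : Type := ℝ × State n

/-- The open slab `(0, T) × ℝⁿ`, on which weak derivatives are taken. -/
def slab (n : ℕ) (T : ℝ) : TopologicalSpace.Opens (SpaceTime n) :=
  ⟨Ioo 0 T ×ˢ univ, isOpen_Ioo.prod isOpen_univ⟩

/-- Lebesgue measure on the slab (the faces `t = 0` and `t = T` are null sets). -/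
noncomputable def slabMeasure (n : ℕ) (T : ℝ) : Measure (SpaceTime n) :=
  volume.restrict (slab n T : Set (SpaceTime n))

/-! ### Weak derivatives and Sobolev spaces on the slab -/

/-- The coordinate directions of space-time: index `0` is time, index `j + 1` is `y_j`. -/
noncomputable def coordVec (n : ℕ) : Fin (n + 1) → SpaceTime n :=
  Fin.cases (1, 0) (fun j => (0, EuclideanSpace.single j 1))

/-- The classical partial derivative in the `k`-th coordinate of space-time. -/
noncomputable def partialDeriv {n : ℕ} (k : Fin (n + 1)) (φ : SpaceTime n → ℝ) :
    SpaceTime n → ℝ :=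
  fun z => fderiv ℝ φ z (coordVec n k)

/-- The classical derivative `D^γ φ` for a multi-index `γ`. -/
noncomputable def multiDeriv {n : ℕ} (γ : Fin (n + 1) → ℕ) (φ : SpaceTime n → ℝ) :
    SpaceTime n → ℝ :=
  (List.finRange (n + 1)).foldr (fun k ψ => (partialDeriv k)^[γ k] ψ) φ

/-- `g ∈ L²` is the weak derivative `D^γ u` of `u` on the slab. -/
def HasWeakDeriv {n : ℕ} (T : ℝ) (γ : Fin (n + 1) → ℕ) (u g : SpaceTime n → ℝ) : Prop :=
  LocallyIntegrableOn u (slab n T : Set (SpaceTime n)) volume ∧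
  MemLp g 2 (slabMeasure n T) ∧
  ∀ φ : 𝓓(slab n T, ℝ),
    ∫ z, u z * multiDeriv γ φ z ∂(slabMeasure n T) =
      (-1) ^ (∑ k, γ k) * ∫ z, g z * φ z ∂(slabMeasure n T)

open Classical in
/-- The weak derivative `D^γ u ∈ L²` (a representative of it; `0` if there is none). -/
noncomputable def weakDeriv {n : ℕ} (T : ℝ) (γ : Fin (n + 1) → ℕ) (u : SpaceTime n → ℝ) :
    SpaceTime n → ℝ :=
  if h : ∃ g, HasWeakDeriv T γ u g then h.choose else 0

/-- The multi-indices `γ` on space-time with `|γ| ≤ r`. -/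
def multiIndices (n r : ℕ) : Finset (Fin (n + 1) → ℕ) :=
  (Fintype.piFinset fun _ => Finset.range (r + 1)).filter fun γ => ∑ k, γ k ≤ r

/-- `u ∈ H^r([0, T] × ℝⁿ, ℝ)`: all weak derivatives of order at most `r` exist in `L²`. -/
def MemSobolev {n : ℕ} (T : ℝ) (r : ℕ) (u : SpaceTime n → ℝ) : Prop :=
  ∀ γ ∈ multiIndices n r, ∃ g, HasWeakDeriv T γ u g

/-- `‖u‖²_{H^r} = ∑_{|γ| ≤ r} ‖D^γ u‖²_{L²}` for `u ∈ H^r([0, T] × ℝⁿ, ℝ)`. -/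
noncomputable def sobolevNormSq {n : ℕ} (T : ℝ) (r : ℕ) (u : SpaceTime n → ℝ) : ℝ :=
  ∑ γ ∈ multiIndices n r, ∫ z, weakDeriv T γ u z ^ 2 ∂(slabMeasure n T)

/-! ### The coefficients -/

/-- The exponent `d(m) = 2 (m + 1) + ⌊n / 2⌋` (division of natural numbers). -/
def sobolevExponent (n m : ℕ) : ℕ := 2 * (m + 1) + n / 2

/-- A pair `(a, b)` of a matrix-valued and a vector-valued function of `(t, y)`. -/
abbrev Coeff (n : ℕ) : Type :=
  (SpaceTime n → Matrix (Fin n) (Fin n) ℝ) × (SpaceTime n → State n)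

/-- The Hilbert space `H_m = H^{d(m)}(ℝ^{n × n}) × H^{d(m)}(ℝⁿ)`. -/
def coeffSpace (n m : ℕ) (T : ℝ) : Set (Coeff n) :=
  {c | (∀ i j, MemSobolev T (sobolevExponent n m) fun z => c.1 z i j) ∧
    ∀ i, MemSobolev T (sobolevExponent n m) fun z => c.2 z i}

/-- `‖(a, b)‖²` in `H_m`. -/
noncomputable def coeffNormSq {n : ℕ} (m : ℕ) (T : ℝ) (c : Coeff n) : ℝ :=
  (∑ i, ∑ j, sobolevNormSq T (sobolevExponent n m) fun z => c.1 z i j) +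
    ∑ i, sobolevNormSq T (sobolevExponent n m) fun z => c.2 z i

/-- The cone `H⁺_m`: pairs in `H_m` such that `a` takes values in `Sym₊(n)`. -/
def coeffCone (n m : ℕ) (T : ℝ) : Set (Coeff n) :=
  {c | c ∈ coeffSpace n m T ∧ ∀ t ∈ Icc 0 T, ∀ y, (c.1 (t, y)).PosSemidef}

/-- The set `H⁺_{m,R_*}`: pairs in `H⁺_m` such that `supp (a(t, ·), b(t, ·))` lies in the closed
ball of radius `R_*` around `0`, for every `t ∈ [0, T]`. -/
def feasibleSet (n m : ℕ) (T Rstar : ℝ) : Set (Coeff n) :=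
  {c | c ∈ coeffCone n m T ∧
    ∀ t ∈ Icc 0 T, tsupport (fun y => (c.1 (t, y), c.2 (t, y))) ⊆ Metric.closedBall 0 Rstar}

/-! ### The Kolmogorov generator and its dual -/

/-- `∂φ/∂y_i` for `φ : ℝⁿ → ℝ`. -/
noncomputable def spaceDeriv {n : ℕ} (i : Fin n) (φ : State n → ℝ) : State n → ℝ :=
  fun y => fderiv ℝ φ y (EuclideanSpace.single i 1)

/-- The Kolmogorov generator
`L_t φ = ½ ∑_{ij} (a + α I)_{ij}(t, ·) ∂²φ/∂y_i∂y_j + ∑_i b_i(t, ·) ∂φ/∂y_i`. -/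
noncomputable def generator {n : ℕ} (α : ℝ) (c : Coeff n) (t : ℝ) (φ : State n → ℝ)
    (y : State n) : ℝ :=
  1 / 2 * ∑ i, ∑ j, (c.1 (t, y) + α • (1 : Matrix (Fin n) (Fin n) ℝ)) i j *
      spaceDeriv i (spaceDeriv j φ) y +
    ∑ i, c.2 (t, y) i * spaceDeriv i φ y

/-- `q ∈ L²([0, T] × ℝⁿ)` is `(t, y) ↦ (L_t)^* p(t, ·)(y)`, in the sense of duality. -/
def IsDualGenerator {n : ℕ} (T α : ℝ) (c : Coeff n) (p q : SpaceTime n → ℝ) : Prop :=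
  MemLp q 2 (slabMeasure n T) ∧
  ∀ φ : 𝓓(slab n T, ℝ),
    Integrable (fun z => p z * generator α c z.1 (fun y => φ (z.1, y)) z.2) (slabMeasure n T) ∧
    ∫ z, q z * φ z ∂(slabMeasure n T) =
      ∫ z, p z * generator α c z.1 (fun y => φ (z.1, y)) z.2 ∂(slabMeasure n T)

open Classical in
/-- The function `(L_t)^* p ∈ L²` (a representative of it; `0` if there is none). -/
noncomputable def dualGenerator {n : ℕ} (T α : ℝ) (c : Coeff n) (p : SpaceTime n → ℝ) :
    SpaceTime n → ℝ :=
  if h : ∃ q, IsDualGenerator T α c p q then h.choose else 0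

/-- The multi-index of `∂/∂t`. -/
def timeIndex (n : ℕ) : Fin (n + 1) → ℕ := Pi.single 0 1

/-- The Fokker-Planck residual `∫₀ᵀ ‖∂p/∂t(t, ·) - (L_t)^* p(t, ·)‖²_{L²} dt`. -/
noncomputable def fpResidual {n : ℕ} (T α : ℝ) (p : SpaceTime n → ℝ) (c : Coeff n) : ℝ :=
  ∫ t in Icc 0 T, ∫ y : State n,
    (weakDeriv T (timeIndex n) p (t, y) - dualGenerator T α c p (t, y)) ^ 2

/-- The cost `L_λ(a, b)` of the learning problem at the density `p`. -/
noncomputable def learningCost {n : ℕ} (m : ℕ) (T α lam : ℝ) (p : SpaceTime n → ℝ)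
    (c : Coeff n) : ℝ :=
  fpResidual T α p c + lam * coeffNormSq m T c

/-! ### The model density -/

/-- The Bessel function of the first kind `J_ν`, for `ν ≥ 0` and `x ≥ 0`. -/
noncomputable def besselJ (ν x : ℝ) : ℝ :=
  ∑' k : ℕ, (-1) ^ k / (k.factorial * Real.Gamma (k + ν + 1)) * (x / 2) ^ (2 * (k : ℝ) + ν)

/-- `ρ_R(x) = R^{n/2} ‖x‖^{-n/2} J_{n/2}(2π R ‖x‖)`, extended continuously to `x = 0`. -/
noncomputable def rho (n : ℕ) (R : ℝ) (x : State n) : ℝ :=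
  if x = 0 then R ^ n * Real.pi ^ ((n : ℝ) / 2) / Real.Gamma ((n : ℝ) / 2 + 1)
  else R ^ ((n : ℝ) / 2) * ‖x‖ ^ (-((n : ℝ) / 2)) * besselJ ((n : ℝ) / 2) (2 * Real.pi * R * ‖x‖)

/-- The Sobolev (Matérn) kernel of smoothness `m + 1` on `ℝ`, that is
`(2^{-m} / m!) r^{m + 1/2} 𝒦_{m + 1/2}(r)` with `r = |s - t|` and `𝒦` the modified Bessel function
of the second kind, written with the closed form
`𝒦_{m + 1/2}(r) = √(π / (2r)) e^{-r} ∑_{k ≤ m} (m + k)! / (k! (m - k)! (2r)^k)`. -/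
noncomputable def sobolevKernel (m : ℕ) (s t : ℝ) : ℝ :=
  Real.sqrt (Real.pi / 2) / (2 ^ m * m.factorial) * Real.exp (-|s - t|) *
    ∑ k ∈ Finset.range (m + 1),
      ((m + k).factorial : ℝ) / (k.factorial * (m - k).factorial * 2 ^ k) * |s - t| ^ (m - k)

/-- The sampling times `t_ℓ = T (ℓ - 1) / (M - 1)`, `ℓ = 1, …, M` (here `ℓ` counts from `0`). -/
noncomputable def sampleTime (T : ℝ) {M : ℕ} (l : Fin M) : ℝ := T * l / ((M : ℝ) - 1)

/-- The Gram matrix `G_{jk} = K_{m+1}(t_j, t_k)`. -/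
noncomputable def gram (m : ℕ) (T : ℝ) (M : ℕ) : Matrix (Fin M) (Fin M) ℝ :=
  Matrix.of fun j k => sobolevKernel m (sampleTime T j) (sampleTime T k)

/-- `c_ℓ(t) = e_ℓᵀ G⁻¹ v(t)` with `v(t) = (K_{m+1}(t, t_1), …, K_{m+1}(t, t_M))`. -/
noncomputable def interpCoeff (m : ℕ) (T : ℝ) {M : ℕ} (l : Fin M) (t : ℝ) : ℝ :=
  ((gram m T M)⁻¹.mulVec fun k => sobolevKernel m t (sampleTime T k)) l

/-- The model density `p̂(t, x) = ∑_ℓ c_ℓ(t) (1/N) ∑_j ρ_R(x - X_{ℓ,j})` of the samples `X`. -/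
noncomputable def modelDensity {n : ℕ} (m : ℕ) (T R : ℝ) {M N : ℕ} (X : Fin M → Fin N → State n) :
    SpaceTime n → ℝ :=
  fun z => ∑ l, interpCoeff m T l z.1 * (1 / (N : ℝ) * ∑ j, rho n R (z.2 - X l j))

end FPLearning

namespace FPLearning

open Filter Topology ContDiff FourierTransform

variable {n : ℕ} {T : ℝ}

/-! ### Derivatives of test functions -/

/-! The problem is a projection onto a closed convex set in a Hilbert space. To a pair $(a,b)$
attach the vector made of the residual $\partial_t\hat p-(\mathcal L^{a,b})^*\hat p$ and of
$\sqrt\lambda$ times every weak derivative, of order at most $d(m)$, of every component. It lies in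
a finite $\ell^2$-sum of copies of $L^2$ (`GraphSpace`), and its squared norm is $L_\lambda(a,b)$
(`IsGraph.learningCost_eq`). The dependence on $(a,b)$ is affine, so the feasible pairs give a
nonempty convex set $K$. If $K$ is closed, it has a unique element of least norm. The coordinates of
order zero give back $(a,b)$ almost everywhere, and uniqueness follows (`existsUnique_minimizer`).

Closedness (`exists_isGraph_of_tendsto`) needs no estimate of the residual by the coefficients. Weak
derivatives are closed under $L^2$ limits. The residual is identified against test functions, where
the derivatives fall on the test function. Semidefiniteness and the support condition survive along
an almost everywhere convergent subsequence, and the limit is set to zero where they fail.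

It remains to give meaning to the cost. The density is a finite sum of terms $c_\ell(t)\psi_\ell(x)$
with $\psi_\ell$ band-limited: the real part of the Fourier transform of a bounded function with
bounded support. Such functions are smooth, and they and all their derivatives are bounded and in
$L^2$. Multiplying a Sobolev coefficient by $\hat p$ therefore keeps two spatial weak derivatives in
$L^2$, which is what $(\mathcal L^{a,b})^*\hat p$ requires
(`IsSeparatedDensity.exists_isDualGenerator`).

Two facts about special functions enter. The Matérn profile $e^{-r}P(r)$ has zero slope at $r=0$
when $m\ge1$ (`maternPoly_coeff`), so $c_\ell$ is differentiable. And $\rho_R$ is the Fourier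
transform of the indicator of the ball of radius $R$ (`rho_eq_integral_cos`), which is obtained by
expanding the cosine and comparing the even moments of the ball with the Bessel series. -/

theorem tsupport_partialDeriv_subset (k : Fin (n + 1)) (φ : SpaceTime n → ℝ) :
    tsupport (partialDeriv k φ) ⊆ tsupport φ := by
  refine (closure_mono fun z hz => ?_).trans (tsupport_fderiv_subset ℝ (f := φ))
  intro h
  apply hz
  simp only [partialDeriv, h, zero_apply]

/-- The partial derivative of a test function, as a test function. -/
noncomputable def testDeriv (k : Fin (n + 1)) (φ : 𝓓(slab n T, ℝ)) : 𝓓(slab n T, ℝ) where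
  toFun := partialDeriv k φ
  contDiff' := (φ.contDiff.fderiv_right (m := ∞) (by simp)).clm_apply contDiff_const
  hasCompactSupport' := φ.hasCompactSupport.mono'
    (subset_closure.trans (tsupport_partialDeriv_subset k φ))
  tsupport_subset' := (tsupport_partialDeriv_subset k φ).trans φ.tsupport_subset

@[simp] theorem coe_testDeriv (k : Fin (n + 1)) (φ : 𝓓(slab n T, ℝ)) :
    ⇑(testDeriv k φ) = partialDeriv k φ := rfl

/-- The product of a test function with a smooth function. -/
noncomputable def testMul (W : SpaceTime n → ℝ) (hW : ContDiff ℝ ∞ W) (φ : 𝓓(slab n T, ℝ)) :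
    𝓓(slab n T, ℝ) where
  toFun := fun z => W z * φ z
  contDiff' := hW.mul φ.contDiff
  hasCompactSupport' := φ.hasCompactSupport.mul_left
  tsupport_subset' := (tsupport_mul_subset_right (f := W)).trans φ.tsupport_subset

@[simp] theorem coe_testMul (W : SpaceTime n → ℝ) (hW : ContDiff ℝ ∞ W) (φ : 𝓓(slab n T, ℝ)) :
    ⇑(testMul W hW φ) = fun z => W z * φ z := rfl

theorem partialDeriv_comm (j k : Fin (n + 1)) {φ : SpaceTime n → ℝ} (hφ : ContDiff ℝ ∞ φ) :
    partialDeriv j (partialDeriv k φ) = partialDeriv k (partialDeriv j φ) := by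
  have hd : Differentiable ℝ (fderiv ℝ φ) :=
    (hφ.fderiv_right (m := 1) (by norm_cast)).differentiable (by norm_num)
  have key : ∀ (a b : Fin (n + 1)) z, partialDeriv a (partialDeriv b φ) z =
      fderiv ℝ (fderiv ℝ φ) z (coordVec n a) (coordVec n b) := by
    intro a b z
    change fderiv ℝ (fun z => fderiv ℝ φ z (coordVec n b)) z (coordVec n a) = _
    rw [fderiv_clm_apply (hd z) (differentiableAt_const _)]
    simp
  funext z
  rw [key, key]
  exact (hφ.contDiffAt (x := z)).isSymmSndFDerivAt
    (by
      rw [minSmoothness_of_isRCLikeNormedField]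
      exact WithTop.coe_le_coe.2 (le_top (a := (2 : ℕ∞)))) _ _

theorem iterate_partialDeriv_test (k : Fin (n + 1)) (i : ℕ) (φ : 𝓓(slab n T, ℝ)) :
    ∃ χ : 𝓓(slab n T, ℝ), ⇑χ = (partialDeriv k)^[i] φ := by
  induction i with
  | zero => exact ⟨φ, rfl⟩
  | succ i ih =>
    obtain ⟨χ, hχ⟩ := ih
    exact ⟨testDeriv k χ, by rw [Function.iterate_succ_apply', coe_testDeriv, hχ]⟩

theorem iterate_partialDeriv_comm (j k : Fin (n + 1)) (i : ℕ) (φ : 𝓓(slab n T, ℝ)) :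
    (partialDeriv k)^[i] (partialDeriv j φ) = partialDeriv j ((partialDeriv k)^[i] φ) := by
  induction i with
  | zero => rfl
  | succ i ih =>
    obtain ⟨χ, hχ⟩ := iterate_partialDeriv_test k i φ
    rw [Function.iterate_succ_apply', Function.iterate_succ_apply', ih, ← hχ,
      partialDeriv_comm k j χ.contDiff]

theorem foldr_partialDeriv_test (γ : Fin (n + 1) → ℕ) (l : List (Fin (n + 1)))
    (φ : 𝓓(slab n T, ℝ)) :
    ∃ χ : 𝓓(slab n T, ℝ), ⇑χ = l.foldr (fun k ψ => (partialDeriv k)^[γ k] ψ) φ := by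
  induction l with
  | nil => exact ⟨φ, rfl⟩
  | cons k l ih =>
    obtain ⟨χ, hχ⟩ := ih
    obtain ⟨χ', hχ'⟩ := iterate_partialDeriv_test k (γ k) χ
    exact ⟨χ', by rw [hχ', hχ, List.foldr_cons]⟩

theorem exists_test_multiDeriv (γ : Fin (n + 1) → ℕ) (φ : 𝓓(slab n T, ℝ)) :
    ∃ χ : 𝓓(slab n T, ℝ), ⇑χ = multiDeriv γ φ :=
  foldr_partialDeriv_test γ _ φ

theorem foldr_partialDeriv_congr {γ γ' : Fin (n + 1) → ℕ} (l : List (Fin (n + 1)))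
    (φ : SpaceTime n → ℝ) (h : ∀ k ∈ l, γ k = γ' k) :
    l.foldr (fun k ψ => (partialDeriv k)^[γ k] ψ) φ =
      l.foldr (fun k ψ => (partialDeriv k)^[γ' k] ψ) φ := by
  induction l with
  | nil => rfl
  | cons k l ih =>
    rw [List.foldr_cons, List.foldr_cons, ih fun a ha => h a (List.mem_cons_of_mem k ha),
      h k List.mem_cons_self]

/-- The list has no repetition, so the extra derivative appears at exactly one place; from there it
commutes outwards past the remaining ones. -/
theorem foldr_partialDeriv_single_add (j : Fin (n + 1)) (γ : Fin (n + 1) → ℕ)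
    (l : List (Fin (n + 1))) (hl : l.Nodup) (hj : j ∈ l) (φ : 𝓓(slab n T, ℝ)) :
    l.foldr (fun k ψ => (partialDeriv k)^[(Pi.single j 1 + γ : Fin (n + 1) → ℕ) k] ψ) φ =
      partialDeriv j (l.foldr (fun k ψ => (partialDeriv k)^[γ k] ψ) φ) := by
  induction l with
  | nil => simp at hj
  | cons k l ih =>
    rw [List.foldr_cons, List.foldr_cons]
    obtain ⟨hk, hl'⟩ := List.nodup_cons.1 hl
    obtain ⟨χ, hχ⟩ := foldr_partialDeriv_test γ l φ
    by_cases hjk : j = k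
    · subst hjk
      rw [foldr_partialDeriv_congr (γ' := γ) l φ fun a ha => by
        have : a ≠ j := fun h => hk (h ▸ ha)
        simp [this]]
      rw [Pi.add_apply, Pi.single_eq_same, add_comm, Function.iterate_succ_apply']
    · rw [ih hl' ((List.mem_cons.1 hj).resolve_left hjk), ← hχ, Pi.add_apply,
        Pi.single_eq_of_ne (fun h => hjk h.symm), zero_add, iterate_partialDeriv_comm]

theorem multiDeriv_single_add (j : Fin (n + 1)) (γ : Fin (n + 1) → ℕ) (φ : 𝓓(slab n T, ℝ)) :
    multiDeriv (Pi.single j 1 + γ) φ = partialDeriv j (multiDeriv γ φ) :=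
  foldr_partialDeriv_single_add j γ _ (List.nodup_finRange _) (List.mem_finRange j) φ

theorem multiDeriv_zero (φ : SpaceTime n → ℝ) : multiDeriv 0 φ = φ := by
  have : ∀ l : List (Fin (n + 1)),
      l.foldr (fun k ψ => (partialDeriv k)^[(0 : Fin (n + 1) → ℕ) k] ψ) φ = φ := by
    intro l
    induction l with
    | nil => rfl
    | cons k l ih => rw [List.foldr_cons, ih]; rfl
  exact this _

theorem multiDeriv_single (j : Fin (n + 1)) (φ : 𝓓(slab n T, ℝ)) :
    multiDeriv (Pi.single j 1) φ = partialDeriv j φ := by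
  have := multiDeriv_single_add j 0 φ
  rwa [add_zero, multiDeriv_zero] at this

/-! ### Pairing with test functions and the fundamental lemma -/

theorem test_eq_zero (φ : 𝓓(slab n T, ℝ)) {z : SpaceTime n} (hz : z ∉ (slab n T : Set _)) :
    φ z = 0 :=
  image_eq_zero_of_notMem_tsupport fun h => hz (φ.tsupport_subset h)

theorem setIntegral_slab {f : SpaceTime n → ℝ}
    (h : ∀ z, z ∉ (slab n T : Set (SpaceTime n)) → f z = 0) :
    ∫ z, f z ∂(slabMeasure n T) = ∫ z, f z :=
  setIntegral_eq_integral_of_forall_compl_eq_zero h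

theorem memLp_test (φ : 𝓓(slab n T, ℝ)) (p : ENNReal) : MemLp φ p (slabMeasure n T) :=
  (φ.continuous.memLp_of_hasCompactSupport φ.hasCompactSupport).restrict _

theorem integrable_mul_test {u : SpaceTime n → ℝ}
    (hu : LocallyIntegrableOn u (slab n T : Set (SpaceTime n)) volume) (φ : 𝓓(slab n T, ℝ)) :
    Integrable (fun z => u z * φ z) (slabMeasure n T) := by
  have hK : IntegrableOn u (tsupport φ) volume :=
    hu.integrableOn_compact_subset φ.tsupport_subset φ.hasCompactSupport
  have h1 : IntegrableOn (fun z => u z * φ z) (tsupport φ) volume :=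
    hK.mul_continuousOn φ.continuous.continuousOn φ.hasCompactSupport
  have h2 : Integrable (fun z => u z * φ z) volume := by
    refine (integrableOn_iff_integrable_of_support_subset fun z hz => ?_).1 h1
    exact subset_closure (right_ne_zero_of_mul hz)
  exact h2.restrict

theorem locallyIntegrableOn_of_memLp {u : SpaceTime n → ℝ} (hu : MemLp u 2 (slabMeasure n T)) :
    LocallyIntegrableOn u (slab n T : Set (SpaceTime n)) volume := by
  refine (locallyIntegrableOn_iff (slab n T).isOpen.isLocallyClosed).2 ?_
  intro K hK hKc
  have h1 : MemLp u 2 (volume.restrict K) := hu.mono_measure (Measure.restrict_mono hK le_rfl)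
  have : IsFiniteMeasure (volume.restrict K) := ⟨by simpa using hKc.measure_lt_top⟩
  exact h1.integrable (by norm_num)

/-- The fundamental lemma of the calculus of variations on the slab. -/
theorem ae_eq_of_integral_test {u v : SpaceTime n → ℝ}
    (hu : LocallyIntegrableOn u (slab n T : Set (SpaceTime n)) volume)
    (hv : LocallyIntegrableOn v (slab n T : Set (SpaceTime n)) volume)
    (h : ∀ φ : 𝓓(slab n T, ℝ), ∫ z, u z * φ z ∂(slabMeasure n T) =
      ∫ z, v z * φ z ∂(slabMeasure n T)) : u =ᵐ[slabMeasure n T] v := by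
  have key := IsOpen.ae_eq_zero_of_integral_contDiff_smul_eq_zero (slab n T).isOpen (hu.sub hv)
    (fun g hg hc hs => by
      let φ : 𝓓(slab n T, ℝ) := ⟨g, hg, hc, hs⟩
      have h1 := h φ
      have h2 : ∫ z, (u z * φ z - v z * φ z) ∂(slabMeasure n T) = 0 := by
        rw [integral_sub (integrable_mul_test hu φ) (integrable_mul_test hv φ), h1, sub_self]
      rw [setIntegral_slab (fun z hz => by simp [test_eq_zero φ hz])] at h2
      rw [← h2]
      refine integral_congr_ae (Eventually.of_forall fun z => ?_)
      change g z * (u z - v z) = u z * g z - v z * g z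
      ring)
  refine (ae_restrict_iff' (slab n T).isOpen.measurableSet).2 ?_
  filter_upwards [key] with z hz hzs
  exact sub_eq_zero.1 (hz hzs)

/-! ### Weak derivatives -/

theorem HasWeakDeriv.ae_unique {γ : Fin (n + 1) → ℕ} {u g g' : SpaceTime n → ℝ}
    (h : HasWeakDeriv T γ u g) (h' : HasWeakDeriv T γ u g') : g =ᵐ[slabMeasure n T] g' := by
  refine ae_eq_of_integral_test (locallyIntegrableOn_of_memLp h.2.1)
    (locallyIntegrableOn_of_memLp h'.2.1) fun φ => ?_
  exact mul_left_cancel₀ (pow_ne_zero _ (by norm_num)) ((h.2.2 φ).symm.trans (h'.2.2 φ))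

theorem LocallyIntegrableOn.congr_slab {u v : SpaceTime n → ℝ}
    (hu : LocallyIntegrableOn u (slab n T : Set (SpaceTime n)) volume)
    (huv : u =ᵐ[slabMeasure n T] v) :
    LocallyIntegrableOn v (slab n T : Set (SpaceTime n)) volume := by
  intro x hx
  obtain ⟨s, hs, h⟩ := hu x hx
  refine ⟨s ∩ (slab n T : Set (SpaceTime n)), inter_mem hs self_mem_nhdsWithin, ?_⟩
  exact (h.mono_set inter_subset_left).congr_fun_ae
    (ae_mono (Measure.restrict_mono inter_subset_right le_rfl) huv)

theorem HasWeakDeriv.congr {γ : Fin (n + 1) → ℕ} {u v g g' : SpaceTime n → ℝ}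
    (h : HasWeakDeriv T γ u g) (huv : u =ᵐ[slabMeasure n T] v)
    (hg : g =ᵐ[slabMeasure n T] g') : HasWeakDeriv T γ v g' := by
  refine ⟨LocallyIntegrableOn.congr_slab h.1 huv, h.2.1.ae_eq hg, fun φ => ?_⟩
  have h1 := integral_congr_ae (huv.mul (EventuallyEq.refl _ (multiDeriv γ φ)))
  have h2 := integral_congr_ae (hg.mul (EventuallyEq.refl _ (φ : SpaceTime n → ℝ)))
  exact h1.symm.trans ((h.2.2 φ).trans (congrArg _ h2))

theorem integrable_mul_multiDeriv {u : SpaceTime n → ℝ}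
    (hu : LocallyIntegrableOn u (slab n T : Set (SpaceTime n)) volume) (γ : Fin (n + 1) → ℕ)
    (φ : 𝓓(slab n T, ℝ)) : Integrable (fun z => u z * multiDeriv γ φ z) (slabMeasure n T) := by
  obtain ⟨χ, hχ⟩ := exists_test_multiDeriv γ φ
  rw [← hχ]
  exact integrable_mul_test hu χ

theorem HasWeakDeriv.add {γ : Fin (n + 1) → ℕ} {u v g g' : SpaceTime n → ℝ}
    (h : HasWeakDeriv T γ u g) (h' : HasWeakDeriv T γ v g') :
    HasWeakDeriv T γ (fun z => u z + v z) (fun z => g z + g' z) := by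
  refine ⟨h.1.add h'.1, h.2.1.add h'.2.1, fun φ => ?_⟩
  simp only [add_mul]
  rw [integral_add (integrable_mul_multiDeriv h.1 γ φ) (integrable_mul_multiDeriv h'.1 γ φ),
    integral_add (integrable_mul_test (locallyIntegrableOn_of_memLp h.2.1) φ)
      (integrable_mul_test (locallyIntegrableOn_of_memLp h'.2.1) φ), h.2.2 φ, h'.2.2 φ, mul_add]

theorem HasWeakDeriv.const_mul {γ : Fin (n + 1) → ℕ} {u g : SpaceTime n → ℝ}
    (h : HasWeakDeriv T γ u g) (r : ℝ) :
    HasWeakDeriv T γ (fun z => r * u z) (fun z => r * g z) := by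
  refine ⟨h.1.smul r, h.2.1.const_mul r, fun φ => ?_⟩
  simp only [mul_assoc]
  rw [integral_const_mul, integral_const_mul, h.2.2 φ]
  ring

theorem hasWeakDeriv_zero (γ : Fin (n + 1) → ℕ) :
    HasWeakDeriv T γ (fun _ => 0) (fun _ : SpaceTime n => 0) :=
  ⟨locallyIntegrableOn_zero, MemLp.zero, fun φ => by simp⟩

theorem HasWeakDeriv.sum {ι : Type*} (s : Finset ι) {γ : Fin (n + 1) → ℕ}
    {u g : ι → SpaceTime n → ℝ} (h : ∀ i ∈ s, HasWeakDeriv T γ (u i) (g i)) :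
    HasWeakDeriv T γ (fun z => ∑ i ∈ s, u i z) (fun z => ∑ i ∈ s, g i z) := by
  classical
  induction s using Finset.induction_on with
  | empty => simpa using hasWeakDeriv_zero γ
  | insert a s ha ih =>
    simp only [Finset.sum_insert ha]
    exact (h a (Finset.mem_insert_self a s)).add
      (ih fun i hi => h i (Finset.mem_insert_of_mem hi))

theorem hasWeakDeriv_single_iff (k : Fin (n + 1)) (u g : SpaceTime n → ℝ) :
    HasWeakDeriv T (Pi.single k 1) u g ↔
      LocallyIntegrableOn u (slab n T : Set (SpaceTime n)) volume ∧ MemLp g 2 (slabMeasure n T) ∧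
      ∀ φ : 𝓓(slab n T, ℝ), ∫ z, u z * partialDeriv k φ z ∂(slabMeasure n T) =
        - ∫ z, g z * φ z ∂(slabMeasure n T) := by
  have h1 : ∑ i, (Pi.single k 1 : Fin (n + 1) → ℕ) i = 1 := by simp
  simp only [HasWeakDeriv, multiDeriv_single, h1, pow_one, neg_mul, one_mul]

theorem hasWeakDeriv_zero_index {u g : SpaceTime n → ℝ} (h : HasWeakDeriv T 0 u g) :
    u =ᵐ[slabMeasure n T] g := by
  refine ae_eq_of_integral_test h.1 (locallyIntegrableOn_of_memLp h.2.1) fun φ => ?_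
  have := h.2.2 φ
  simpa only [multiDeriv_zero, Pi.zero_apply, Finset.sum_const_zero, pow_zero, one_mul] using this

/-- A further weak derivative of a first order weak derivative. -/
theorem HasWeakDeriv.of_single_add {j k : Fin (n + 1)} {u g g' : SpaceTime n → ℝ}
    (h : HasWeakDeriv T (Pi.single k 1) u g)
    (h' : HasWeakDeriv T (Pi.single j 1 + Pi.single k 1) u g') :
    HasWeakDeriv T (Pi.single j 1) g g' := by
  rw [hasWeakDeriv_single_iff] at h ⊢
  refine ⟨locallyIntegrableOn_of_memLp h.2.1, h'.2.1, fun φ => ?_⟩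
  have h1 := h.2.2 (testDeriv j φ)
  have h2 := h'.2.2 φ
  have h3 : ∑ i, (Pi.single j 1 + Pi.single k 1 : Fin (n + 1) → ℕ) i = 2 := by
    simp [Finset.sum_add_distrib]
  -- The defining identity of `g` is tested with $\partial_j\varphi$; its sign $-1$ against the sign
  -- $(-1)^2$ of the second order derivative leaves the sign of a first order one.
  rw [multiDeriv_single_add, multiDeriv_single, partialDeriv_comm j k φ.contDiff, h3] at h2
  rw [coe_testDeriv] at h1
  rw [h1] at h2
  linarith

theorem MemSobolev.hasWeakDeriv {r : ℕ} {u : SpaceTime n → ℝ} (h : MemSobolev T r u)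
    {γ : Fin (n + 1) → ℕ} (hγ : γ ∈ multiIndices n r) :
    HasWeakDeriv T γ u (weakDeriv T γ u) := by
  have h' := h γ hγ
  rw [weakDeriv, dif_pos h']
  exact h'.choose_spec

theorem mem_multiIndices {r : ℕ} {γ : Fin (n + 1) → ℕ} :
    γ ∈ multiIndices n r ↔ ∑ k, γ k ≤ r := by
  simp only [multiIndices, Finset.mem_filter, Fintype.mem_piFinset, Finset.mem_range,
    and_iff_right_iff_imp]
  intro h k
  exact Nat.lt_succ_of_le ((Finset.single_le_sum (fun _ _ => Nat.zero_le _)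
    (Finset.mem_univ k)).trans h)

theorem zero_mem_multiIndices (n r : ℕ) : (0 : Fin (n + 1) → ℕ) ∈ multiIndices n r :=
  mem_multiIndices.2 (by simp)

/-- Pairing with a fixed $L^2$ function is an inner product, hence continuous. -/
theorem tendsto_integral_mul {α : Type*} [MeasurableSpace α] {μ : Measure α}
    {U : ℕ → Lp ℝ 2 μ} {V : Lp ℝ 2 μ} (h : Tendsto U atTop (𝓝 V)) {φ : α → ℝ}
    (hφ : MemLp φ 2 μ) :
    Tendsto (fun k => ∫ z, U k z * φ z ∂μ) atTop (𝓝 (∫ z, V z * φ z ∂μ)) := by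
  have key : ∀ W : Lp ℝ 2 μ, inner ℝ (hφ.toLp φ) W = ∫ z, W z * φ z ∂μ := by
    intro W
    rw [L2.inner_def]
    refine integral_congr_ae ?_
    filter_upwards [hφ.coeFn_toLp] with z hz
    rw [hz]
    rfl
  simp only [← key]
  exact tendsto_const_nhds.inner h

/-- Weak differentiation is a closed operator: both sides of its defining identity are pairings with
fixed $L^2$ functions. -/
theorem hasWeakDeriv_of_tendsto {γ : Fin (n + 1) → ℕ} {U G : ℕ → Lp ℝ 2 (slabMeasure n T)}
    {V H : Lp ℝ 2 (slabMeasure n T)} (hU : Tendsto U atTop (𝓝 V)) (hG : Tendsto G atTop (𝓝 H))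
    (h : ∀ k, HasWeakDeriv T γ (U k) (G k)) : HasWeakDeriv T γ V H := by
  refine ⟨locallyIntegrableOn_of_memLp (Lp.memLp V), Lp.memLp H, fun φ => ?_⟩
  obtain ⟨χ, hχ⟩ := exists_test_multiDeriv γ φ
  have h1 := tendsto_integral_mul hU (memLp_test χ 2)
  have h2 := (tendsto_integral_mul hG (memLp_test φ 2)).const_mul ((-1) ^ (∑ k, γ k))
  rw [hχ] at h1
  exact tendsto_nhds_unique h1 (h2.congr fun k => ((h k).2.2 φ).symm)

/-! ### Band-limited functions -/

/-- A bounded measurable function with bounded support. -/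
def IsBandSymbol (f : State n → ℂ) : Prop :=
  AEStronglyMeasurable f volume ∧ ∃ C r : ℝ, ∀ ξ, ‖f ξ‖ ≤ C ∧ (r < ‖ξ‖ → f ξ = 0)

/-- `ψ` is the real part of the Fourier transform of a bounded function with bounded support. -/
def IsBandLimited (ψ : State n → ℝ) : Prop :=
  ∃ f : State n → ℂ, IsBandSymbol f ∧ ψ = fun x => (𝓕 f x).re

theorem IsBandSymbol.memLp {f : State n → ℂ} (hf : IsBandSymbol f) (p : ENNReal) :
    MemLp f p volume := by
  obtain ⟨hm, C, r, h⟩ := hf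
  have h1 : MemLp f p (volume.restrict (Metric.closedBall 0 r)) := by
    have : IsFiniteMeasure (volume.restrict (Metric.closedBall (0 : State n) r)) :=
      ⟨by simpa using measure_closedBall_lt_top⟩
    exact MemLp.of_bound hm.restrict C (Eventually.of_forall fun ξ => (h ξ).1)
  have h2 : (Metric.closedBall (0 : State n) r).indicator f = f := by
    rw [indicator_eq_self]
    intro ξ hξ
    by_contra hc
    exact hξ ((h ξ).2 (by simpa using hc))
  rw [← h2]
  exact (memLp_indicator_iff_restrict Metric.isClosed_closedBall.measurableSet).2 h1

/-- A continuous multiplier is bounded on a ball containing the support, whatever its growth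
outside. Linear factors give derivatives, characters give translations, constants give scalings. -/
theorem IsBandSymbol.continuous_mul {f g : State n → ℂ} (hf : IsBandSymbol f) (hg : Continuous g) :
    IsBandSymbol fun ξ => g ξ * f ξ := by
  obtain ⟨hm, C, r, h⟩ := hf
  obtain ⟨D, hD⟩ := (isCompact_closedBall (0 : State n) r).exists_bound_of_continuousOn
    hg.continuousOn
  refine ⟨hg.aestronglyMeasurable.mul hm, |D| * |C|, r, fun ξ => ⟨?_, fun hr => ?_⟩⟩
  · by_cases hr : r < ‖ξ‖
    · simp only [(h ξ).2 hr, mul_zero, norm_zero]; positivity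
    · simp only [norm_mul]
      exact mul_le_mul ((hD ξ (by simpa using hr)).trans (le_abs_self D))
        ((h ξ).1.trans (le_abs_self C)) (norm_nonneg _) (abs_nonneg D)
  · simp only [(h ξ).2 hr, mul_zero]

theorem IsBandSymbol.integrable_pow {f : State n → ℂ} (hf : IsBandSymbol f) (k : ℕ) :
    Integrable (fun ξ => ‖ξ‖ ^ k * ‖f ξ‖) := by
  have h := (hf.continuous_mul (g := fun ξ => ((‖ξ‖ ^ k : ℝ) : ℂ)) (by fun_prop)).memLp 1
  have h1 := (memLp_one_iff_integrable.1 h).norm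
  refine h1.congr (Eventually.of_forall fun ξ => ?_)
  simp

theorem IsBandSymbol.contDiff_fourier {f : State n → ℂ} (hf : IsBandSymbol f) :
    ContDiff ℝ ∞ (𝓕 f) :=
  Real.contDiff_fourier fun k _ => hf.integrable_pow k

theorem IsBandSymbol.fderiv_fourier_apply {f : State n → ℂ} (hf : IsBandSymbol f)
    (x v : State n) : fderiv ℝ (𝓕 f) x v =
      𝓕 (fun ξ => (-(2 * Real.pi * Complex.I) * (inner ℝ ξ v : ℝ)) * f ξ) x := by
  have h1 : Integrable f := memLp_one_iff_integrable.1 (hf.memLp 1)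
  have h2 : Integrable (fun ξ => ‖ξ‖ * ‖f ξ‖) := by simpa using hf.integrable_pow 1
  rw [Real.fderiv_fourier h1 h2, Real.fourier_eq', Real.fourier_eq',
    ContinuousLinearMap.integral_apply]
  · refine integral_congr_ae (Eventually.of_forall fun ξ => ?_)
    simp only [smul_apply, VectorFourier.fourierSMulRight_apply, smul_eq_mul, Complex.real_smul]
    change _ * (_ * (((inner ℝ ξ v : ℝ) : ℂ) * _)) = _
    ring
  · have h3 : Integrable (VectorFourier.fourierSMulRight (innerSL ℝ) f) :=
      (h2.const_mul (2 * Real.pi * ‖innerSL ℝ (E := State n)‖)).mono' h1.1.fourierSMulRight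
        (Eventually.of_forall fun ξ =>
          (VectorFourier.norm_fourierSMulRight_le _ f ξ).trans_eq (by ring))
    have h4 := (Real.fourierIntegral_convergent_iff
      (f := VectorFourier.fourierSMulRight (innerSL ℝ) f) x).2 h3
    refine h4.congr (Eventually.of_forall fun ξ => ?_)
    simp only [Circle.smul_def, Real.fourierChar_apply]
    congr 3
    push_cast
    ring

theorem IsBandLimited.contDiff {ψ : State n → ℝ} (h : IsBandLimited ψ) : ContDiff ℝ ∞ ψ := by
  obtain ⟨f, hf, rfl⟩ := h
  exact Complex.reCLM.contDiff.comp hf.contDiff_fourier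

theorem IsBandLimited.spaceDeriv {ψ : State n → ℝ} (h : IsBandLimited ψ) (i : Fin n) :
    IsBandLimited (spaceDeriv i ψ) := by
  obtain ⟨f, hf, rfl⟩ := h
  refine ⟨_, hf.continuous_mul (g := fun ξ => -(2 * Real.pi * Complex.I) *
    (inner ℝ ξ (EuclideanSpace.single i (1 : ℝ)) : ℝ)) (by fun_prop), ?_⟩
  funext x
  rw [← hf.fderiv_fourier_apply]
  have hd : DifferentiableAt ℝ (𝓕 f) x := hf.contDiff_fourier.differentiable (by simp) x
  have := (Complex.reCLM.hasFDerivAt.comp x hd.hasFDerivAt).fderiv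
  simp only [FPLearning.spaceDeriv]
  change fderiv ℝ (Complex.reCLM ∘ 𝓕 f) x _ = _
  rw [this]
  rfl

theorem IsBandLimited.bounded {ψ : State n → ℝ} (h : IsBandLimited ψ) :
    ∃ C, ∀ x, ‖ψ x‖ ≤ C := by
  obtain ⟨f, hf, rfl⟩ := h
  refine ⟨∫ ξ, ‖f ξ‖, fun x => (Complex.abs_re_le_norm _).trans ?_⟩
  exact VectorFourier.norm_fourierIntegral_le_integral_norm _ _ _ _ _

theorem IsBandLimited.comp_sub {ψ : State n → ℝ} (h : IsBandLimited ψ) (a : State n) :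
    IsBandLimited fun x => ψ (x - a) := by
  obtain ⟨f, hf, rfl⟩ := h
  refine ⟨_, hf.continuous_mul (g := fun ξ => Complex.exp ((2 * Real.pi * inner ℝ ξ a : ℝ) *
    Complex.I)) (by fun_prop), ?_⟩
  funext x
  change (𝓕 f (x - a)).re = _
  congr 1
  rw [Real.fourier_eq', Real.fourier_eq']
  refine integral_congr_ae (Eventually.of_forall fun ξ => ?_)
  simp only [smul_eq_mul]
  rw [← mul_assoc, ← Complex.exp_add, inner_sub_right]
  congr 2
  push_cast
  ring

/-- By Plancherel the class of `f` has an $L^2$ Fourier transform. Moving the transform onto a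
smooth compactly supported function shows that it agrees almost everywhere with the pointwise
Fourier integral. -/
theorem IsBandSymbol.memLp_fourier {f : State n → ℂ} (hf : IsBandSymbol f) :
    MemLp (𝓕 f) 2 volume := by
  have hf1 : Integrable f := memLp_one_iff_integrable.1 (hf.memLp 1)
  set fL : Lp ℂ 2 (volume : Measure (State n)) := (hf.memLp 2).toLp f with hfL
  have key : (𝓕 f : State n → ℂ) =ᵐ[volume] (𝓕 fL : Lp ℂ 2 (volume : Measure (State n))) := by
    refine ae_eq_of_integral_contDiff_smul_eq hf.contDiff_fourier.continuous.locallyIntegrable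
      ((Lp.memLp _).locallyIntegrable (by norm_num)) fun g hg hc => ?_
    have hg₁ : HasCompactSupport (Complex.ofRealCLM ∘ g) := hc.comp_left rfl
    have hg₂ : ContDiff ℝ ∞ (Complex.ofRealCLM ∘ g) := by fun_prop
    set G : SchwartzMap (State n) ℂ := hg₁.toSchwartzMap hg₂ with hG
    have h1 := DFunLike.congr_fun (Lp.fourier_toTemperedDistribution_eq fL) G
    rw [TemperedDistribution.fourier_apply, Lp.toTemperedDistribution_apply,
      Lp.toTemperedDistribution_apply] at h1
    have h2 : ∫ x, (𝓕 G) x • fL x = ∫ x, (𝓕 (G : State n → ℂ)) x • f x := by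
      refine integral_congr_ae ?_
      filter_upwards [(hf.memLp 2).coeFn_toLp] with x hx
      rw [hfL, hx, SchwartzMap.fourier_coe]
    have h3 : ∫ x, (𝓕 (G : State n → ℂ)) x • f x = ∫ x, G x • 𝓕 f x := by
      have := VectorFourier.integral_fourierIntegral_smul_eq_flip (L := innerₗ (State n))
        Real.continuous_fourierChar continuous_inner (μ := volume) (ν := volume)
        (G.integrable (μ := volume)) hf1
      rw [flip_innerₗ] at this
      exact this
    have h4 : ∀ (F : State n → ℂ), ∫ x, g x • F x = ∫ x, G x • F x := fun F => by
      refine integral_congr_ae (Eventually.of_forall fun x => ?_)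
      simp [hG]
    rw [h4, h4, ← h1, h2, h3]
  exact (Lp.memLp _).ae_eq key.symm

theorem IsBandLimited.memLp {ψ : State n → ℝ} (h : IsBandLimited ψ) : MemLp ψ 2 volume := by
  obtain ⟨f, hf, rfl⟩ := h
  exact hf.memLp_fourier.re

/-! ### Products with separated functions -/

/-- Along a spatial line `c` is a constant factor. Using line derivatives in place of Fréchet ones
therefore asks no regularity of `c`. -/
theorem hasLineDerivAt_prodMk {φ : State n → ℝ} {t : ℝ} {y : State n} (hφ : DifferentiableAt ℝ φ y)
    (c : ℝ → ℝ) (i : Fin n) :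
    HasLineDerivAt ℝ (fun z : SpaceTime n => c z.1 * φ z.2) (c t * spaceDeriv i φ y) (t, y)
      (coordVec n i.succ) := by
  have h1 := (hφ.hasFDerivAt.hasLineDerivAt (EuclideanSpace.single i 1))
  have h2 : HasDerivAt (fun s : ℝ => c t * φ (y + s • EuclideanSpace.single i 1))
      (c t * spaceDeriv i φ y) 0 := h1.const_mul (c t)
  refine h2.congr_of_eventuallyEq (Eventually.of_forall fun s => ?_)
  simp [coordVec]

theorem partialDeriv_succ {φ : SpaceTime n → ℝ} {z : SpaceTime n} (hφ : DifferentiableAt ℝ φ z)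
    (i : Fin n) : partialDeriv i.succ φ z = spaceDeriv i (fun y => φ (z.1, y)) z.2 := by
  have h1 : HasFDerivAt (fun y : State n => ((z.1, y) : SpaceTime n))
      (ContinuousLinearMap.inr ℝ ℝ (State n)) z.2 := hasFDerivAt_prodMk_right z.1 z.2
  have h2 := (HasFDerivAt.comp z.2 (g := φ) (f := fun y => (z.1, y)) hφ.hasFDerivAt h1).fderiv
  rw [spaceDeriv]
  change _ = fderiv ℝ (φ ∘ fun y => (z.1, y)) z.2 _
  rw [h2]
  rfl

/-- In this form every term pairs a coefficient with a space-time derivative of `φ`, which is again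
a test function. -/
theorem generator_test (α : ℝ) (c : Coeff n) (φ : 𝓓(slab n T, ℝ)) (z : SpaceTime n) :
    generator α c z.1 (fun y => φ (z.1, y)) z.2 =
      1 / 2 * ∑ i, ∑ j, (c.1 z i j + α * (1 : Matrix (Fin n) (Fin n) ℝ) i j) *
        partialDeriv i.succ (partialDeriv j.succ φ) z +
      ∑ i, c.2 z i * partialDeriv i.succ φ z := by
  have h1 : ∀ (χ : 𝓓(slab n T, ℝ)) (w : SpaceTime n), DifferentiableAt ℝ χ w := fun χ w =>
    χ.contDiff.differentiable (by simp) w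
  have h2 : ∀ j : Fin n, spaceDeriv j (fun y => φ (z.1, y)) =
      fun y => partialDeriv j.succ φ (z.1, y) := fun j => by
    funext y
    exact (partialDeriv_succ (z := (z.1, y)) (h1 φ _) j).symm
  have h3 : ∀ i j : Fin n, spaceDeriv i (spaceDeriv j (fun y => φ (z.1, y))) z.2 =
      partialDeriv i.succ (partialDeriv j.succ φ) z := fun i j => by
    rw [h2]
    exact (partialDeriv_succ (h1 (testDeriv j.succ φ) z) i).symm
  simp only [generator, h3, Matrix.add_apply, Matrix.smul_apply, smul_eq_mul]
  simp only [h2]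

/-- Weierstrass approximation on $[0,T]$. It is needed because a test function times a merely
continuous function of time is no longer a test function, while its product with a polynomial is. -/
theorem integral_continuous_mul_eq_zero {h : SpaceTime n → ℝ} (hh : Integrable h (slabMeasure n T))
    (H : ∀ P : Polynomial ℝ, ∫ z, P.eval z.1 * h z ∂(slabMeasure n T) = 0) {c : ℝ → ℝ}
    (hc : Continuous c) : ∫ z, c z.1 * h z ∂(slabMeasure n T) = 0 := by
  have hslab : ∀ᵐ z ∂(slabMeasure n T), z.1 ∈ Icc 0 T := by
    filter_upwards [ae_restrict_mem (slab n T).isOpen.measurableSet] with z hz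
    exact Ioo_subset_Icc_self hz.1
  have hint : ∀ d : ℝ → ℝ, Continuous d →
      Integrable (fun z => d z.1 * h z) (slabMeasure n T) := fun d hd => by
    obtain ⟨C, hC⟩ := isCompact_Icc.exists_bound_of_continuousOn (s := Icc 0 T) hd.continuousOn
    exact hh.bdd_mul (hd.comp continuous_fst).aestronglyMeasurable (hslab.mono fun z hz => hC _ hz)
  have key : ∀ ε > 0, |∫ z, c z.1 * h z ∂(slabMeasure n T)| ≤
      ε * ∫ z, |h z| ∂(slabMeasure n T) := by
    intro ε hε
    obtain ⟨P, hP⟩ := exists_polynomial_near_of_continuousOn 0 T c hc.continuousOn ε hε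
    have h1 : ∫ z, c z.1 * h z ∂(slabMeasure n T) =
        ∫ z, (c z.1 * h z - P.eval z.1 * h z) ∂(slabMeasure n T) := by
      rw [integral_sub (hint c hc) (hint _ P.continuous), H P, sub_zero]
    rw [h1, ← integral_const_mul]
    refine norm_integral_le_of_norm_le (G := ℝ) (hh.abs.const_mul ε) ?_
    filter_upwards [hslab] with z hz
    rw [← sub_mul, norm_mul, Real.norm_eq_abs, abs_sub_comm]
    exact mul_le_mul_of_nonneg_right (hP _ hz).le (abs_nonneg _)
  refine abs_eq_zero.1 (le_antisymm (ge_of_tendsto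
    (f := fun ε : ℝ => ε * ∫ z, |h z| ∂(slabMeasure n T))
    (x := 𝓝[>] 0) ?_ (eventually_mem_nhdsWithin.mono key)) (abs_nonneg _))
  have : Tendsto (fun ε : ℝ => ε * ∫ z, |h z| ∂(slabMeasure n T)) (𝓝 0)
      (𝓝 (0 * ∫ z, |h z| ∂(slabMeasure n T))) := tendsto_id.mul_const _
  rw [zero_mul] at this
  exact this.mono_left nhdsWithin_le_nhds

theorem memLp_mul_bounded {f g : SpaceTime n → ℝ} (hf : MemLp f 2 (slabMeasure n T))
    (hg : AEStronglyMeasurable g (slabMeasure n T)) {C : ℝ}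
    (hC : ∀ᵐ z ∂(slabMeasure n T), ‖g z‖ ≤ C) :
    MemLp (fun z => f z * g z) 2 (slabMeasure n T) :=
  (memLp_top_of_bound hg C hC).mul' hf

theorem memLp_mul_separated {f : SpaceTime n → ℝ} (hf : MemLp f 2 (slabMeasure n T))
    {c : ℝ → ℝ} (hc : Continuous c) {ψ : State n → ℝ} (hψ : IsBandLimited ψ) :
    MemLp (fun z => f z * (c z.1 * ψ z.2)) 2 (slabMeasure n T) := by
  obtain ⟨C, hC⟩ := isCompact_Icc.exists_bound_of_continuousOn (s := Icc 0 T) hc.continuousOn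
  obtain ⟨D, hD⟩ := hψ.bounded
  have hψc := hψ.contDiff.continuous
  refine memLp_mul_bounded (C := C * D) hf
    (by fun_prop : Continuous fun z : SpaceTime n => c z.1 * ψ z.2).aestronglyMeasurable ?_
  filter_upwards [ae_restrict_mem (slab n T).isOpen.measurableSet] with z hz
  rw [norm_mul]
  exact mul_le_mul (hC _ (Ioo_subset_Icc_self hz.1)) (hD _) (norm_nonneg _)
    ((norm_nonneg _).trans (hC _ (Ioo_subset_Icc_self hz.1)))

theorem partialDeriv_polynomial_mul (P : Polynomial ℝ) {ψ : State n → ℝ} (hψ : ContDiff ℝ ∞ ψ)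
    (φ : 𝓓(slab n T, ℝ)) (i : Fin n) (z : SpaceTime n) :
    partialDeriv i.succ (fun z => (P.eval z.1 * ψ z.2) * φ z) z =
      (P.eval z.1 * ψ z.2) * partialDeriv i.succ φ z +
        (P.eval z.1 * spaceDeriv i ψ z.2) * φ z := by
  have hψd : Differentiable ℝ ψ := hψ.differentiable (by simp)
  have h1 : DifferentiableAt ℝ (fun z : SpaceTime n => P.eval z.1 * ψ z.2) z := by
    have : Differentiable ℝ fun z : SpaceTime n => P.eval z.1 :=
      P.differentiable.comp differentiable_fst
    have h2 : Differentiable ℝ fun z : SpaceTime n => ψ z.2 := hψd.comp differentiable_snd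
    exact (this.mul h2) z
  have h2 : DifferentiableAt ℝ φ z := φ.contDiff.differentiable (by simp) z
  have h3 := (h1.hasFDerivAt.mul h2.hasFDerivAt).fderiv
  have h4 : fderiv ℝ (fun z : SpaceTime n => P.eval z.1 * ψ z.2) z (coordVec n i.succ) =
      P.eval z.1 * spaceDeriv i ψ z.2 :=
    (h1.hasFDerivAt.hasLineDerivAt _).unique (hasLineDerivAt_prodMk (hψd z.2) (fun t => P.eval t) i)
  rw [partialDeriv]
  change fderiv ℝ ((fun z : SpaceTime n => P.eval z.1 * ψ z.2) * (φ : SpaceTime n → ℝ)) z _ = _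
  rw [h3]
  simp only [add_apply, smul_apply, h4, smul_eq_mul, partialDeriv]
  ring

/-- The product rule for weak derivatives in space. -/
theorem HasWeakDeriv.mul_separated {A A' : SpaceTime n → ℝ} {i : Fin n}
    (hA : HasWeakDeriv T (Pi.single i.succ 1) A A') (hA2 : MemLp A 2 (slabMeasure n T))
    {c : ℝ → ℝ} (hc : Continuous c) {ψ : State n → ℝ} (hψ : IsBandLimited ψ) :
    HasWeakDeriv T (Pi.single i.succ 1) (fun z => A z * (c z.1 * ψ z.2))
      (fun z => A' z * (c z.1 * ψ z.2) + A z * (c z.1 * spaceDeriv i ψ z.2)) := by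
  have hA' := (hasWeakDeriv_single_iff _ _ _).1 hA
  have hm1 := memLp_mul_separated hA2 hc hψ
  have hm2 := (memLp_mul_separated hA.2.1 hc hψ).add (memLp_mul_separated hA2 hc (hψ.spaceDeriv i))
  refine (hasWeakDeriv_single_iff _ _ _).2 ⟨locallyIntegrableOn_of_memLp hm1, hm2, fun φ => ?_⟩
  have hs : ∀ P : Polynomial ℝ, ContDiff ℝ ∞ fun z : SpaceTime n => P.eval z.1 * ψ z.2 := fun P =>
    ((Polynomial.contDiff_aeval P ∞).comp contDiff_fst).mul (hψ.contDiff.comp contDiff_snd)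
  -- Moved to one side, the product rule reads $\int c(t)\,h=0$. For polynomial `c` it is the
  -- identity defining `A'`, tested with $c\,\psi\,\varphi$; general `c` follows by approximation.
  set h : SpaceTime n → ℝ := fun z => A z * (ψ z.2 * partialDeriv i.succ φ z) +
    (A' z * (ψ z.2 * φ z) + A z * (spaceDeriv i ψ z.2 * φ z)) with hh
  have i1 : Integrable (fun z => A z * (ψ z.2 * partialDeriv i.succ φ z)) (slabMeasure n T) :=
    integrable_mul_test hA'.1 (testMul _ (hψ.contDiff.comp contDiff_snd) (testDeriv i.succ φ))
  have i2 : Integrable (fun z => A' z * (ψ z.2 * φ z)) (slabMeasure n T) :=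
    integrable_mul_test (locallyIntegrableOn_of_memLp hA'.2.1)
      (testMul _ (hψ.contDiff.comp contDiff_snd) φ)
  have i3 : Integrable (fun z => A z * (spaceDeriv i ψ z.2 * φ z)) (slabMeasure n T) :=
    integrable_mul_test hA'.1 (testMul _ ((hψ.spaceDeriv i).contDiff.comp contDiff_snd) φ)
  have hP : ∀ P : Polynomial ℝ, ∫ z, P.eval z.1 * h z ∂(slabMeasure n T) = 0 := by
    intro P
    have h1 := hA'.2.2 (testMul _ (hs P) φ)
    have j1 := integrable_mul_test hA'.1 (testDeriv i.succ (testMul _ (hs P) φ))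
    have j2 := integrable_mul_test (locallyIntegrableOn_of_memLp hA'.2.1) (testMul _ (hs P) φ)
    rw [eq_neg_iff_add_eq_zero] at h1
    refine Eq.trans ?_ ((integral_add j1 j2).trans h1)
    refine integral_congr_ae (Eventually.of_forall fun z => ?_)
    simp only [coe_testMul, coe_testDeriv, hh, partialDeriv_polynomial_mul P hψ.contDiff φ i z]
    ring
  have key := integral_continuous_mul_eq_zero (i1.add (i2.add i3)) hP hc
  rw [eq_neg_iff_add_eq_zero]
  refine (integral_add
    (integrable_mul_test (locallyIntegrableOn_of_memLp hm1) (testDeriv i.succ φ))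
    (integrable_mul_test (locallyIntegrableOn_of_memLp hm2) φ)).symm.trans (Eq.trans ?_ key)
  refine integral_congr_ae (Eventually.of_forall fun z => ?_)
  simp only [Pi.add_apply, coe_testDeriv]
  ring

/-! ### Integrability and weak derivatives of separated functions -/

theorem slabMeasure_eq_prod (n : ℕ) (T : ℝ) : slabMeasure n T =
    ((volume : Measure ℝ).restrict (Ioo 0 T)).prod (volume : Measure (State n)) := by
  have := Measure.prod_restrict (μ := (volume : Measure ℝ)) (ν := (volume : Measure (State n)))
    (Ioo 0 T) univ
  rw [Measure.restrict_univ] at this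
  rw [this]
  rfl

theorem memLp_separated {c : ℝ → ℝ} {C : ℝ} (hcm : Measurable c) (hcb : ∀ t ∈ Icc 0 T, ‖c t‖ ≤ C)
    {ψ : State n → ℝ} (hψ : MemLp ψ 2 volume) :
    MemLp (fun z : SpaceTime n => c z.1 * ψ z.2) 2 (slabMeasure n T) := by
  rw [slabMeasure_eq_prod]
  have h1 : MemLp c 2 ((volume : Measure ℝ).restrict (Ioo 0 T)) :=
    MemLp.of_bound hcm.aestronglyMeasurable C
      ((ae_restrict_mem measurableSet_Ioo).mono fun t ht => hcb t (Ioo_subset_Icc_self ht))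
  have hm : AEStronglyMeasurable (fun z : SpaceTime n => c z.1 * ψ z.2)
      (((volume : Measure ℝ).restrict (Ioo 0 T)).prod (volume : Measure (State n))) :=
    h1.1.comp_fst.mul hψ.1.comp_snd
  rw [memLp_two_iff_integrable_sq hm]
  refine (h1.integrable_sq.mul_prod hψ.integrable_sq).congr (Eventually.of_forall fun z => ?_)
  simp only [mul_pow]

/-- Test functions vanish off the slab, so all integrals extend to the whole space, where
integration by parts along one direction has no boundary term. Continuity of `w'` is not required;
this serves the time derivative, for which only measurability and boundedness on $[0,T]$ are
established. -/
theorem hasWeakDeriv_of_hasLineDerivAt {w w' : SpaceTime n → ℝ} {k : Fin (n + 1)}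
    (hw : MemLp w 2 (slabMeasure n T)) (hw' : MemLp w' 2 (slabMeasure n T))
    (h : ∀ z, HasLineDerivAt ℝ w (w' z) z (coordVec n k)) :
    HasWeakDeriv T (Pi.single k 1) w w' := by
  refine (hasWeakDeriv_single_iff _ _ _).2 ⟨locallyIntegrableOn_of_memLp hw, hw', fun φ => ?_⟩
  have ext : ∀ {u : SpaceTime n → ℝ} (χ : 𝓓(slab n T, ℝ)), MemLp u 2 (slabMeasure n T) →
      Integrable (fun z => u z * χ z) volume := fun {u} χ hu => by
    refine (integrableOn_iff_integrable_of_support_subset (s := (slab n T : Set (SpaceTime n)))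
      fun z hz => ?_).1 (integrable_mul_test (locallyIntegrableOn_of_memLp hu) χ)
    by_contra hc
    exact hz (by simp [test_eq_zero χ hc])
  rw [setIntegral_slab (fun z hz => by rw [← coe_testDeriv, test_eq_zero _ hz, mul_zero]),
    setIntegral_slab (fun z hz => by rw [test_eq_zero _ hz, mul_zero])]
  have : (volume : Measure (SpaceTime n)).IsAddHaarMeasure :=
    inferInstanceAs ((volume : Measure ℝ).prod (volume : Measure (State n))).IsAddHaarMeasure
  exact integral_bilinear_hasLineDerivAt_right_eq_neg_left_of_integrable
    (B := ContinuousLinearMap.mul ℝ ℝ) (ext φ hw') (ext (testDeriv k φ) hw) (ext φ hw)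
    (fun z _ => h z)
    (fun z _ => (φ.contDiff.differentiable (by simp) z).hasFDerivAt.hasLineDerivAt _)

theorem exists_bound_Icc {c : ℝ → ℝ} (hc : Continuous c) (T : ℝ) :
    ∃ C, ∀ t ∈ Icc 0 T, ‖c t‖ ≤ C :=
  isCompact_Icc.exists_bound_of_continuousOn hc.continuousOn

theorem hasWeakDeriv_space_separated {c : ℝ → ℝ} (hc : Continuous c) {ψ : State n → ℝ}
    (hψ : IsBandLimited ψ) (i : Fin n) :
    HasWeakDeriv T (Pi.single i.succ 1) (fun z : SpaceTime n => c z.1 * ψ z.2)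
      (fun z => c z.1 * spaceDeriv i ψ z.2) := by
  obtain ⟨C, hC⟩ := exists_bound_Icc hc T
  exact hasWeakDeriv_of_hasLineDerivAt (memLp_separated hc.measurable hC hψ.memLp)
    (memLp_separated hc.measurable hC (hψ.spaceDeriv i).memLp)
    fun z => hasLineDerivAt_prodMk (hψ.contDiff.differentiable (by simp) z.2) c i

theorem hasWeakDeriv_time_separated {c c' : ℝ → ℝ} (hc : ∀ t, HasDerivAt c (c' t) t)
    (hc' : Measurable c') (hb : ∃ C, ∀ t ∈ Icc 0 T, ‖c' t‖ ≤ C) {ψ : State n → ℝ}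
    (hψ : IsBandLimited ψ) :
    HasWeakDeriv T (timeIndex n) (fun z : SpaceTime n => c z.1 * ψ z.2)
      (fun z => c' z.1 * ψ z.2) := by
  have hcc : Continuous c := continuous_iff_continuousAt.2 fun t => (hc t).continuousAt
  obtain ⟨C, hC⟩ := exists_bound_Icc hcc T
  obtain ⟨D, hD⟩ := hb
  refine hasWeakDeriv_of_hasLineDerivAt (memLp_separated hcc.measurable hC hψ.memLp)
    (memLp_separated hc' hD hψ.memLp) fun z => ?_
  have h1 : HasDerivAt (fun s : ℝ => c (z.1 + s)) (c' z.1) 0 := by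
    have h2 : HasDerivAt c (c' z.1) (z.1 + 0) := by simpa using hc z.1
    exact h2.comp_const_add z.1 0
  refine (h1.mul_const (ψ z.2)).congr_of_eventuallyEq (Eventually.of_forall fun s => ?_)
  simp [coordVec]

/-! ### The dual of the generator -/

/-- `u` has the weak derivatives `D_i u` and `D_j D_i u`. -/
def HasSecondWeakDeriv (T : ℝ) (i j : Fin n) (u : SpaceTime n → ℝ) : Prop :=
  ∃ v w, HasWeakDeriv T (Pi.single i.succ 1) u v ∧ HasWeakDeriv T (Pi.single j.succ 1) v w

theorem HasSecondWeakDeriv.add {i j : Fin n} {u v : SpaceTime n → ℝ}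
    (hu : HasSecondWeakDeriv T i j u) (hv : HasSecondWeakDeriv T i j v) :
    HasSecondWeakDeriv T i j fun z => u z + v z := by
  obtain ⟨u1, u2, h1, h2⟩ := hu
  obtain ⟨v1, v2, h3, h4⟩ := hv
  exact ⟨_, _, h1.add h3, h2.add h4⟩

theorem HasSecondWeakDeriv.const_mul {i j : Fin n} {u : SpaceTime n → ℝ}
    (hu : HasSecondWeakDeriv T i j u) (r : ℝ) : HasSecondWeakDeriv T i j fun z => r * u z := by
  obtain ⟨u1, u2, h1, h2⟩ := hu
  exact ⟨_, _, h1.const_mul r, h2.const_mul r⟩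

theorem HasSecondWeakDeriv.sum {ι : Type*} (s : Finset ι) {i j : Fin n}
    {u : ι → SpaceTime n → ℝ} (h : ∀ l ∈ s, HasSecondWeakDeriv T i j (u l)) :
    HasSecondWeakDeriv T i j fun z => ∑ l ∈ s, u l z := by
  choose! v w h1 h2 using h
  exact ⟨_, _, HasWeakDeriv.sum s h1, HasWeakDeriv.sum s h2⟩

theorem HasSecondWeakDeriv.exists_integral {i j : Fin n} {u : SpaceTime n → ℝ}
    (hu : HasSecondWeakDeriv T i j u) :
    ∃ g, MemLp g 2 (slabMeasure n T) ∧ ∀ φ : 𝓓(slab n T, ℝ),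
      Integrable (fun z => u z * partialDeriv i.succ (partialDeriv j.succ φ) z) (slabMeasure n T) ∧
      ∫ z, g z * φ z ∂(slabMeasure n T) =
        ∫ z, u z * partialDeriv i.succ (partialDeriv j.succ φ) z ∂(slabMeasure n T) := by
  obtain ⟨v, w, h1, h2⟩ := hu
  rw [hasWeakDeriv_single_iff] at h1 h2
  refine ⟨w, h2.2.1, fun φ =>
    ⟨integrable_mul_test h1.1 (testDeriv i.succ (testDeriv j.succ φ)), ?_⟩⟩
  have := h1.2.2 (testDeriv j.succ φ)
  rw [coe_testDeriv] at this
  rw [this, h2.2.2 φ, neg_neg]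

theorem HasWeakDeriv.exists_integral {i : Fin n} {u v : SpaceTime n → ℝ}
    (hu : HasWeakDeriv T (Pi.single i.succ 1) u v) :
    ∃ g, MemLp g 2 (slabMeasure n T) ∧ ∀ φ : 𝓓(slab n T, ℝ),
      Integrable (fun z => u z * partialDeriv i.succ φ z) (slabMeasure n T) ∧
      ∫ z, g z * φ z ∂(slabMeasure n T) =
        ∫ z, u z * partialDeriv i.succ φ z ∂(slabMeasure n T) := by
  rw [hasWeakDeriv_single_iff] at hu
  refine ⟨fun z => - v z, hu.2.1.neg, fun φ =>
    ⟨integrable_mul_test hu.1 (testDeriv i.succ φ), ?_⟩⟩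
  rw [hu.2.2 φ, ← integral_neg]
  simp only [neg_mul]

/-- A finite sum of products of a continuous function of time and a band-limited function. -/
def IsSeparatedDensity (p : SpaceTime n → ℝ) : Prop :=
  ∃ (L : ℕ) (c : Fin L → ℝ → ℝ) (ψ : Fin L → State n → ℝ), (∀ l, Continuous (c l)) ∧
    (∀ l, IsBandLimited (ψ l)) ∧ p = fun z => ∑ l, c l z.1 * ψ l z.2

theorem MemSobolev.hasWeakDeriv_single {r : ℕ} {A : SpaceTime n → ℝ} (hA : MemSobolev T r A)
    (hr : 1 ≤ r) (k : Fin (n + 1)) :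
    HasWeakDeriv T (Pi.single k 1) A (weakDeriv T (Pi.single k 1) A) :=
  hA.hasWeakDeriv (mem_multiIndices.2 (by simpa using hr))

theorem MemSobolev.memLp {r : ℕ} {A : SpaceTime n → ℝ} (hA : MemSobolev T r A) :
    MemLp A 2 (slabMeasure n T) := by
  have h := hA.hasWeakDeriv (zero_mem_multiIndices n r)
  exact h.2.1.ae_eq (hasWeakDeriv_zero_index h).symm

/-- The product rule is used on $A\psi$ and again on both terms $A'\psi$ and $A\,\partial_i\psi$,
which is possible because $\partial_i\psi$ is band-limited too. -/
theorem hasSecondWeakDeriv_mul_separated {r : ℕ} {A : SpaceTime n → ℝ} (hA : MemSobolev T r A)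
    (hr : 2 ≤ r) {c : ℝ → ℝ} (hc : Continuous c) {ψ : State n → ℝ} (hψ : IsBandLimited ψ)
    (i j : Fin n) : HasSecondWeakDeriv T i j fun z => A z * (c z.1 * ψ z.2) := by
  have hi := hA.hasWeakDeriv_single (one_le_two.trans hr) i.succ
  have hj := hA.hasWeakDeriv_single (one_le_two.trans hr) j.succ
  have hij := hA.hasWeakDeriv (γ := Pi.single j.succ 1 + Pi.single i.succ 1)
    (mem_multiIndices.2 (by simpa [Finset.sum_add_distrib] using hr))
  exact ⟨_, _, hi.mul_separated hA.memLp hc hψ,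
    ((hi.of_single_add hij).mul_separated hi.2.1 hc hψ).add
      (hj.mul_separated hA.memLp hc (hψ.spaceDeriv i))⟩

theorem hasSecondWeakDeriv_separated {c : ℝ → ℝ} (hc : Continuous c) {ψ : State n → ℝ}
    (hψ : IsBandLimited ψ) (i j : Fin n) :
    HasSecondWeakDeriv T i j fun z : SpaceTime n => c z.1 * ψ z.2 :=
  ⟨_, _, hasWeakDeriv_space_separated hc hψ i, hasWeakDeriv_space_separated hc (hψ.spaceDeriv i) j⟩

/-- `(L_t)^* p` exists in `L²` for coefficients with two weak derivatives in `L²`. -/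
theorem IsSeparatedDensity.exists_isDualGenerator {p : SpaceTime n → ℝ} (hp : IsSeparatedDensity p)
    {r : ℕ} (hr : 2 ≤ r) (α : ℝ) {c : Coeff n} (h1 : ∀ i j, MemSobolev T r fun z => c.1 z i j)
    (h2 : ∀ i, MemSobolev T r fun z => c.2 z i) : ∃ q, IsDualGenerator T α c p q := by
  obtain ⟨L, d, ψ, hd, hψ, hp⟩ := hp
  have hsec : ∀ i j : Fin n, HasSecondWeakDeriv T i j fun z =>
      (c.1 z i j + α * (1 : Matrix (Fin n) (Fin n) ℝ) i j) * p z := by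
    intro i j
    -- The constant $\alpha I$ cannot be absorbed into the Sobolev coefficient, since constants need
    -- not be in $L^2$ of the unbounded slab; $\alpha I p$ is treated by the regularity of `p`
    -- alone.
    have := (HasSecondWeakDeriv.sum Finset.univ fun l _ =>
      hasSecondWeakDeriv_mul_separated (h1 i j) hr (hd l) (hψ l) i j).add
      ((HasSecondWeakDeriv.sum (T := T) Finset.univ fun l _ =>
        hasSecondWeakDeriv_separated (hd l) (hψ l) i j).const_mul
          (α * (1 : Matrix (Fin n) (Fin n) ℝ) i j))
    simpa only [hp, add_mul, Finset.mul_sum, Finset.sum_add_distrib] using this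
  have hfst : ∀ i : Fin n, ∃ v, HasWeakDeriv T (Pi.single i.succ 1)
      (fun z => c.2 z i * p z) v := by
    intro i
    have := HasWeakDeriv.sum Finset.univ fun l _ =>
      ((h2 i).hasWeakDeriv_single (one_le_two.trans hr) i.succ).mul_separated (h2 i).memLp
        (hd l) (hψ l)
    refine Exists.intro (fun z => ∑ l, (weakDeriv T (Pi.single i.succ 1) (fun z => c.2 z i) z *
      (d l z.1 * ψ l z.2) + c.2 z i * (d l z.1 * spaceDeriv i (ψ l) z.2))) ?_
    · simpa only [hp, Finset.mul_sum] using this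
  choose G hG hGφ using fun i j => (hsec i j).exists_integral
  choose v hv using hfst
  choose H hH hHφ using fun i => (hv i).exists_integral
  refine ⟨fun z => 1 / 2 * ∑ i, ∑ j, G i j z + ∑ i, H i z, ?_, fun φ => ?_⟩
  · exact ((memLp_finsetSum _ fun i _ => memLp_finsetSum _ fun j _ => hG i j).const_mul _).add
      (memLp_finsetSum _ fun i _ => hH i)
  · have hgen : (fun z => p z *
        generator α c z.1 (fun y => φ (z.1, y)) z.2) = fun z =>
        1 / 2 * ∑ i, ∑ j, ((c.1 z i j + α * (1 : Matrix (Fin n) (Fin n) ℝ) i j) *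
          p z) * partialDeriv i.succ (partialDeriv j.succ φ) z +
        ∑ i, (c.2 z i * p z) * partialDeriv i.succ φ z := by
      funext z
      rw [generator_test, mul_add, mul_left_comm, Finset.mul_sum, Finset.mul_sum (s := Finset.univ)
        (a := p z) (f := fun i => c.2 z i * partialDeriv i.succ φ z)]
      congr 2
      · refine Finset.sum_congr rfl fun i _ => ?_
        rw [Finset.mul_sum]
        exact Finset.sum_congr rfl fun j _ => by ring
      · funext i
        ring
    have e1 : Integrable (fun z => ∑ i, ∑ j,
        ((c.1 z i j + α * (1 : Matrix (Fin n) (Fin n) ℝ) i j) * p z) *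
          partialDeriv i.succ (partialDeriv j.succ φ) z) (slabMeasure n T) :=
      integrable_finsetSum _ fun i _ => integrable_finsetSum _ fun j _ => (hGφ i j φ).1
    have e2 : Integrable (fun z => ∑ i, (c.2 z i * p z) *
        partialDeriv i.succ φ z) (slabMeasure n T) :=
      integrable_finsetSum _ fun i _ => (hHφ i φ).1
    have f1 : ∀ i j, Integrable (fun z => G i j z * φ z) (slabMeasure n T) := fun i j =>
      integrable_mul_test (locallyIntegrableOn_of_memLp (hG i j)) φ
    have f2 : ∀ i, Integrable (fun z => H i z * φ z) (slabMeasure n T) := fun i =>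
      integrable_mul_test (locallyIntegrableOn_of_memLp (hH i)) φ
    refine ⟨hgen ▸ (e1.const_mul _).add e2, ?_⟩
    rw [hgen, integral_add (e1.const_mul _) e2, integral_const_mul,
      integral_finsetSum _ fun i _ => integrable_finsetSum _ fun j _ => (hGφ i j φ).1,
      integral_finsetSum _ fun i _ => (hHφ i φ).1]
    have hsplit : ∀ z, (1 / 2 * ∑ i, ∑ j, G i j z + ∑ i, H i z) * φ z =
        1 / 2 * ∑ i, ∑ j, G i j z * φ z + ∑ i, H i z * φ z := fun z => by
      simp only [add_mul, mul_assoc, Finset.sum_mul]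
    simp only [hsplit]
    rw [integral_add ((integrable_finsetSum _ fun i _ => integrable_finsetSum _ fun j _ =>
      f1 i j).const_mul _) (integrable_finsetSum _ fun i _ => f2 i), integral_const_mul,
      integral_finsetSum _ fun i _ => integrable_finsetSum _ fun j _ => f1 i j,
      integral_finsetSum _ fun i _ => f2 i]
    congr 1
    · congr 1
      refine Finset.sum_congr rfl fun i _ => ?_
      rw [integral_finsetSum _ fun j _ => f1 i j, integral_finsetSum _ fun j _ => (hGφ i j φ).1]
      exact Finset.sum_congr rfl fun j _ => (hGφ i j φ).2
    · exact Finset.sum_congr rfl fun i _ => (hHφ i φ).2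

/-! ### The learning problem as a projection in a Hilbert space -/

/-- Indices of the scalar components of a pair `(a, b)`. -/
abbrev CompIndex (n : ℕ) : Type := (Fin n × Fin n) ⊕ Fin n

/-- The scalar components of a pair `(a, b)`. -/
def comp (c : Coeff n) : CompIndex n → SpaceTime n → ℝ :=
  Sum.elim (fun ij z => c.1 z ij.1 ij.2) (fun i z => c.2 z i)

/-- The Hilbert space of a residual and of all weak derivatives of all components. -/
abbrev GraphSpace (n r : ℕ) (T : ℝ) : Type :=
  PiLp 2 fun _ : Option (CompIndex n × multiIndices n r) => Lp ℝ 2 (slabMeasure n T)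

/-- `v` consists of the residual `g - (L_t)^* p` and the scaled weak derivatives of `c`. -/
def IsGraph (α κ : ℝ) (p g : SpaceTime n → ℝ) (r : ℕ) (c : Coeff n) (v : GraphSpace n r T) : Prop :=
  IsDualGenerator T α c p (fun z => g z - v none z) ∧
  ∀ s (γ : multiIndices n r), HasWeakDeriv T (γ : Fin (n + 1) → ℕ)
    (fun z => κ * comp c s z) (v (some (s, γ)))

theorem mem_coeffSpace_iff {m : ℕ} {c : Coeff n} :
    c ∈ coeffSpace n m T ↔ ∀ s, MemSobolev T (sobolevExponent n m) (comp c s) := by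
  constructor
  · rintro ⟨h1, h2⟩ (⟨i, j⟩ | i)
    · exact h1 i j
    · exact h2 i
  · exact fun h => ⟨fun i j => h (.inl (i, j)), fun i => h (.inr i)⟩

theorem coeffNormSq_eq_sum (m : ℕ) (c : Coeff n) :
    coeffNormSq m T c = ∑ s, sobolevNormSq T (sobolevExponent n m) (comp c s) := by
  rw [Fintype.sum_sum_type, Fintype.sum_prod_type]
  rfl

theorem norm_sq_lp {α : Type*} [MeasurableSpace α] {μ : Measure α} (f : Lp ℝ 2 μ) :
    ‖f‖ ^ 2 = ∫ z, f z ^ 2 ∂μ := by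
  rw [← real_inner_self_eq_norm_sq, L2.inner_def]
  refine integral_congr_ae (Eventually.of_forall fun z => ?_)
  simp only [real_inner_self_eq_norm_sq, Real.norm_eq_abs, sq_abs]

theorem IsDualGenerator.ae_unique {α : ℝ} {c : Coeff n} {p q q' : SpaceTime n → ℝ}
    (h : IsDualGenerator T α c p q) (h' : IsDualGenerator T α c p q') :
    q =ᵐ[slabMeasure n T] q' :=
  ae_eq_of_integral_test (locallyIntegrableOn_of_memLp h.1) (locallyIntegrableOn_of_memLp h'.1)
    fun φ => (h.2 φ).2.trans (h'.2 φ).2.symm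

theorem IsDualGenerator.congr {α : ℝ} {c : Coeff n} {p q q' : SpaceTime n → ℝ}
    (h : IsDualGenerator T α c p q) (hq : q =ᵐ[slabMeasure n T] q') :
    IsDualGenerator T α c p q' := by
  refine ⟨h.1.ae_eq hq, fun φ => ⟨(h.2 φ).1, ?_⟩⟩
  rw [← (h.2 φ).2]
  exact (integral_congr_ae (hq.mul (EventuallyEq.refl _ (φ : SpaceTime n → ℝ)))).symm

theorem IsDualGenerator.dualGenerator_ae_eq {α : ℝ} {c : Coeff n} {p q : SpaceTime n → ℝ}
    (h : IsDualGenerator T α c p q) : dualGenerator T α c p =ᵐ[slabMeasure n T] q := by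
  have h' : ∃ q, IsDualGenerator T α c p q := ⟨q, h⟩
  rw [dualGenerator, dif_pos h']
  exact h'.choose_spec.ae_unique h

theorem HasWeakDeriv.weakDeriv_ae_eq {γ : Fin (n + 1) → ℕ} {u g : SpaceTime n → ℝ}
    (h : HasWeakDeriv T γ u g) : weakDeriv T γ u =ᵐ[slabMeasure n T] g := by
  have h' : ∃ g, HasWeakDeriv T γ u g := ⟨g, h⟩
  rw [weakDeriv, dif_pos h']
  exact h'.choose_spec.ae_unique h

/-- Fubini merges the iterated integral into one over the slab, and almost everywhere uniqueness
makes the chosen representatives immaterial. -/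
theorem fpResidual_eq {α : ℝ} {c : Coeff n} {p g q : SpaceTime n → ℝ}
    (hg : HasWeakDeriv T (timeIndex n) p g) (hq : IsDualGenerator T α c p q) :
    fpResidual T α p c = ∫ z, (g z - q z) ^ 2 ∂(slabMeasure n T) := by
  have h1 : (fun z => (weakDeriv T (timeIndex n) p z - dualGenerator T α c p z) ^ 2)
      =ᵐ[slabMeasure n T] fun z => (g z - q z) ^ 2 := by
    filter_upwards [hg.weakDeriv_ae_eq, hq.dualGenerator_ae_eq] with z h1 h2
    rw [h1, h2]
  have h2 : Integrable (fun z => (g z - q z) ^ 2) (slabMeasure n T) :=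
    (hg.2.1.sub hq.1).integrable_sq
  rw [← integral_congr_ae h1, fpResidual, integral_Icc_eq_integral_Ioo]
  replace h2 := h2.congr h1.symm
  rw [slabMeasure_eq_prod] at h2 ⊢
  exact (integral_prod _ h2).symm

/-- The scale $\kappa=\sqrt\lambda$ turns $\lambda\|D^\gamma u\|^2$ into the squared norm of the
coordinate holding $D^\gamma(\kappa u)$. -/
theorem IsGraph.learningCost_eq {m : ℕ} {α lam : ℝ} (hlam : 0 < lam) {p g : SpaceTime n → ℝ}
    (hg : HasWeakDeriv T (timeIndex n) p g) {c : Coeff n}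
    {v : GraphSpace n (sobolevExponent n m) T}
    (h : IsGraph α (Real.sqrt lam) p g (sobolevExponent n m) c v) :
    learningCost m T α lam p c = ‖v‖ ^ 2 := by
  have hκ : Real.sqrt lam ≠ 0 := (Real.sqrt_pos.2 hlam).ne'
  rw [PiLp.norm_sq_eq_of_L2, Fintype.sum_option, learningCost, fpResidual_eq hg h.1,
    Fintype.sum_prod_type, norm_sq_lp, coeffNormSq_eq_sum, Finset.mul_sum]
  congr 1
  · simp only [sub_sub_cancel]
  · refine Finset.sum_congr rfl fun s _ => ?_
    rw [sobolevNormSq, Finset.mul_sum, ← Finset.sum_coe_sort]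
    refine Finset.sum_congr rfl fun γ _ => ?_
    have h1 := (h.2 s γ).const_mul (Real.sqrt lam)⁻¹
    simp only [inv_mul_cancel_left₀ hκ] at h1
    rw [norm_sq_lp, ← integral_const_mul]
    refine integral_congr_ae ?_
    filter_upwards [h1.weakDeriv_ae_eq] with z hz
    rw [hz, mul_pow, inv_pow, Real.sq_sqrt hlam.le, mul_inv_cancel_left₀ hlam.ne']

theorem exists_isGraph {m : ℕ} {α κ : ℝ} {p g : SpaceTime n → ℝ} (hg : MemLp g 2 (slabMeasure n T))
    {c : Coeff n} (hc : c ∈ coeffSpace n m T) (hq : ∃ q, IsDualGenerator T α c p q) :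
    ∃ v, IsGraph (T := T) α κ p g (sobolevExponent n m) c v := by
  obtain ⟨q, hq⟩ := hq
  have hD : ∀ s (γ : multiIndices n (sobolevExponent n m)), HasWeakDeriv T (γ : Fin (n + 1) → ℕ)
      (fun z => κ * comp c s z) (fun z => κ * weakDeriv T γ (comp c s) z) := fun s γ =>
    ((mem_coeffSpace_iff.1 hc s).hasWeakDeriv γ.2).const_mul κ
  refine ⟨WithLp.toLp 2 fun i => i.elim ((hg.sub hq.1).toLp _)
    fun sγ => (hD sγ.1 sγ.2).2.1.toLp _, hq.congr ?_, fun s γ => ?_⟩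
  · filter_upwards [(hg.sub hq.1).coeFn_toLp] with z hz
    change _ = g z - ((hg.sub hq.1).toLp _ : Lp ℝ 2 (slabMeasure n T)) z
    rw [hz]
    simp
  · exact (hD s γ).congr (EventuallyEq.refl _ _) (hD s γ).2.1.coeFn_toLp.symm

/-- Because of $\alpha I$ the generator is only affine in the coefficients, hence the condition
$a+b=1$. -/
theorem generator_convex_comb (α : ℝ) {a b : ℝ} (hab : a + b = 1) (c c' : Coeff n) (t : ℝ)
    (φ : State n → ℝ) (y : State n) :
    generator α (a • c + b • c') t φ y = a * generator α c t φ y + b * generator α c' t φ y := by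
  have h1 : ∀ i j, ((a • c + b • c').1 (t, y) + α • (1 : Matrix (Fin n) (Fin n) ℝ)) i j =
      a * (c.1 (t, y) + α • (1 : Matrix (Fin n) (Fin n) ℝ)) i j +
        b * (c'.1 (t, y) + α • (1 : Matrix (Fin n) (Fin n) ℝ)) i j := fun i j => by
    change a * c.1 (t, y) i j + b * c'.1 (t, y) i j + α * (1 : Matrix (Fin n) (Fin n) ℝ) i j =
      a * (c.1 (t, y) i j + α * (1 : Matrix (Fin n) (Fin n) ℝ) i j) +
        b * (c'.1 (t, y) i j + α * (1 : Matrix (Fin n) (Fin n) ℝ) i j)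
    linear_combination (-α * (1 : Matrix (Fin n) (Fin n) ℝ) i j) * hab
  have h2 : ∀ i, (a • c + b • c').2 (t, y) i = a * c.2 (t, y) i + b * c'.2 (t, y) i := fun i => rfl
  simp only [generator, h1, h2, add_mul, Finset.sum_add_distrib, mul_add, mul_assoc,
    ← Finset.mul_sum]
  ring

theorem IsDualGenerator.convex_comb {α a b : ℝ} (hab : a + b = 1) {c c' : Coeff n}
    {p q q' : SpaceTime n → ℝ} (h : IsDualGenerator T α c p q)
    (h' : IsDualGenerator T α c' p q') :
    IsDualGenerator T α (a • c + b • c') p (fun z => a * q z + b * q' z) := by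
  refine ⟨(h.1.const_mul a).add (h'.1.const_mul b), fun φ => ?_⟩
  have e : (fun z : SpaceTime n => p z * generator α (a • c + b • c') z.1
      (fun y => φ (z.1, y)) z.2) = fun z =>
      a * (p z * generator α c z.1 (fun y => φ (z.1, y)) z.2) +
      b * (p z * generator α c' z.1 (fun y => φ (z.1, y)) z.2) := by
    funext z
    rw [generator_convex_comb α hab]
    ring
  have i1 := (h.2 φ).1.const_mul a
  have i2 := (h'.2 φ).1.const_mul b
  refine ⟨e ▸ i1.add i2, ?_⟩
  rw [e, integral_add i1 i2, integral_const_mul, integral_const_mul, ← (h.2 φ).2, ← (h'.2 φ).2,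
    ← integral_const_mul, ← integral_const_mul, ← integral_add]
  · refine integral_congr_ae (Eventually.of_forall fun z => ?_)
    simp only
    ring
  · exact (integrable_mul_test (locallyIntegrableOn_of_memLp h.1) φ).const_mul a
  · exact (integrable_mul_test (locallyIntegrableOn_of_memLp h'.1) φ).const_mul b

theorem comp_convex_comb (a b : ℝ) (c c' : Coeff n) (s : CompIndex n) (z : SpaceTime n) :
    comp (a • c + b • c') s z = a * comp c s z + b * comp c' s z := by
  rcases s with ⟨i, j⟩ | i <;> rfl

theorem IsGraph.convex_comb {r : ℕ} {α κ a b : ℝ} (hab : a + b = 1) {p g : SpaceTime n → ℝ}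
    {c c' : Coeff n} {v v' : GraphSpace n r T} (h : IsGraph α κ p g r c v)
    (h' : IsGraph α κ p g r c' v') :
    IsGraph α κ p g r (a • c + b • c') (a • v + b • v') := by
  have hcoe : ∀ i, ((a • v + b • v' : GraphSpace n r T) i : SpaceTime n → ℝ)
      =ᵐ[slabMeasure n T] fun z => a * v i z + b * v' i z := fun i => by
    rw [PiLp.add_apply, PiLp.smul_apply, PiLp.smul_apply]
    filter_upwards [Lp.coeFn_add (a • v i) (b • v' i), Lp.coeFn_smul a (v i),
      Lp.coeFn_smul b (v' i)] with z h1 h2 h3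
    rw [h1, Pi.add_apply, h2, h3]
    rfl
  refine ⟨(h.1.convex_comb hab h'.1).congr ?_, fun s γ => ?_⟩
  · filter_upwards [hcoe none] with z hz
    rw [hz]
    linear_combination g z * hab
  · refine (((h.2 s γ).const_mul a).add ((h'.2 s γ).const_mul b)).congr
      (Eventually.of_forall fun z => ?_) (hcoe _).symm
    simp only [comp_convex_comb]
    ring

/-- A point of the Hilbert space determines its coefficients almost everywhere. This yields
uniqueness of the minimizer and lets limits be read off the coordinates of order zero. -/
theorem IsGraph.comp_ae_eq {r : ℕ} {α κ : ℝ} (hκ : κ ≠ 0) {p g : SpaceTime n → ℝ}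
    {c : Coeff n} {v : GraphSpace n r T} (h : IsGraph α κ p g r c v) (s : CompIndex n) :
    comp c s =ᵐ[slabMeasure n T]
      fun z => κ⁻¹ * v (some (s, ⟨0, zero_mem_multiIndices n r⟩)) z := by
  filter_upwards [hasWeakDeriv_zero_index (h.2 s ⟨0, zero_mem_multiIndices n r⟩)] with z hz
  rw [← hz, inv_mul_cancel_left₀ hκ]

theorem ae_eq_of_comp {c c' : Coeff n}
    (h : ∀ s, comp c s =ᵐ[slabMeasure n T] comp c' s) :
    c.1 =ᵐ[slabMeasure n T] c'.1 ∧ c.2 =ᵐ[slabMeasure n T] c'.2 := by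
  have h' := ae_all_iff.2 h
  constructor
  · filter_upwards [h'] with z hz
    ext i j
    exact hz (.inl (i, j))
  · filter_upwards [h'] with z hz
    ext i
    exact hz (.inr i)

theorem feasibleSet_convex_comb {m : ℕ} {Rstar a b : ℝ} (ha : 0 ≤ a) (hb : 0 ≤ b)
    {c c' : Coeff n} (h : c ∈ feasibleSet n m T Rstar) (h' : c' ∈ feasibleSet n m T Rstar) :
    a • c + b • c' ∈ feasibleSet n m T Rstar := by
  refine ⟨⟨mem_coeffSpace_iff.2 fun s γ hγ => ?_, fun t ht y => ?_⟩, fun t ht => ?_⟩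
  · have h1 := ((mem_coeffSpace_iff.1 h.1.1 s).hasWeakDeriv hγ).const_mul a
    have h2 := ((mem_coeffSpace_iff.1 h'.1.1 s).hasWeakDeriv hγ).const_mul b
    exact ⟨_, (h1.add h2).congr
      (Eventually.of_forall fun z => (comp_convex_comb a b c c' s z).symm) (EventuallyEq.refl _ _)⟩
  · exact ((h.1.2 t ht y).smul ha).add ((h'.1.2 t ht y).smul hb)
  · refine closure_minimal (fun y hy => ?_) Metric.isClosed_closedBall
    by_contra hc
    apply hy
    have h1 := image_eq_zero_of_notMem_tsupport (fun hh => hc (h.2 t ht hh))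
    have h2 := image_eq_zero_of_notMem_tsupport (fun hh => hc (h'.2 t ht hh))
    rw [Prod.mk_eq_zero] at h1 h2 ⊢
    change a • c.1 (t, y) + b • c'.1 (t, y) = 0 ∧ a • c.2 (t, y) + b • c'.2 (t, y) = 0
    simp [h1, h2]

theorem zero_mem_feasibleSet (n m : ℕ) (T Rstar : ℝ) :
    (0 : Coeff n) ∈ feasibleSet n m T Rstar := by
  refine ⟨⟨mem_coeffSpace_iff.2 fun s γ _ => ⟨_, (hasWeakDeriv_zero γ).congr
    (Eventually.of_forall fun z => ?_) (EventuallyEq.refl _ _)⟩,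
    fun t _ y => Matrix.PosSemidef.zero⟩,
    fun t _ => ?_⟩
  · rcases s with ⟨i, j⟩ | i <;> rfl
  · refine closure_minimal (fun y hy => ?_) Metric.isClosed_closedBall
    exact absurd rfl hy

/-! ### Closedness of the graph -/

/-- $L^2$ convergence gives convergence in measure, hence an almost everywhere convergent
subsequence; extracting once per index makes it common to the finite family. -/
theorem exists_subseq_tendsto_ae {α ι : Type*} [MeasurableSpace α] {μ : Measure α}
    {V : ℕ → ι → Lp ℝ 2 μ} {W : ι → Lp ℝ 2 μ} (h : ∀ i, Tendsto (fun k => V k i) atTop (𝓝 (W i)))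
    (s : Finset ι) : ∃ ns : ℕ → ℕ, StrictMono ns ∧
      ∀ i ∈ s, ∀ᵐ z ∂μ, Tendsto (fun k => V (ns k) i z) atTop (𝓝 (W i z)) := by
  classical
  induction s using Finset.induction_on with
  | empty => exact ⟨id, strictMono_id, by simp⟩
  | insert a s _ ih =>
    obtain ⟨ns, hns, hs⟩ := ih
    have h1 := tendstoInMeasure_of_tendsto_Lp ((h a).comp hns.tendsto_atTop)
    obtain ⟨ms, hms, ha⟩ := h1.exists_seq_tendsto_ae
    refine ⟨ns ∘ ms, hns.comp hms, fun i hi => ?_⟩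
    rcases Finset.mem_insert.1 hi with rfl | hi
    · exact ha
    · filter_upwards [hs i hi] with z hz
      exact hz.comp hms.tendsto_atTop

theorem posSemidef_of_tendsto {A : ℕ → Matrix (Fin n) (Fin n) ℝ} {B : Matrix (Fin n) (Fin n) ℝ}
    (hA : ∀ k, (A k).PosSemidef) (h : ∀ i j, Tendsto (fun k => A k i j) atTop (𝓝 (B i j))) :
    B.PosSemidef := by
  refine Matrix.PosSemidef.of_dotProduct_mulVec_nonneg ?_ fun x => ?_
  · ext i j
    exact tendsto_nhds_unique (h j i) ((h i j).congr fun k => ((hA k).isHermitian.apply i j).symm)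
  · have h1 : Tendsto (fun k => star x ⬝ᵥ (A k).mulVec x) atTop (𝓝 (star x ⬝ᵥ B.mulVec x)) := by
      simp only [dotProduct, Matrix.mulVec]
      exact tendsto_finsetSum _ fun i _ => tendsto_const_nhds.mul
        (tendsto_finsetSum _ fun j _ => (h i j).mul tendsto_const_nhds)
    exact ge_of_tendsto' h1 fun k => (hA k).dotProduct_mulVec_nonneg x

/-- The differential operator of the generator belonging to a scalar component. -/
noncomputable def compDeriv (φ : SpaceTime n → ℝ) : CompIndex n → SpaceTime n → ℝ :=
  Sum.elim (fun ij z => 1 / 2 * partialDeriv ij.1.succ (partialDeriv ij.2.succ φ) z)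
    (fun i z => partialDeriv i.succ φ z)

/-- The $\alpha$ terms cancel, so the difference is linear in the components. -/
theorem generator_sub (α : ℝ) (c c' : Coeff n) (φ : 𝓓(slab n T, ℝ)) (z : SpaceTime n) :
    generator α c z.1 (fun y => φ (z.1, y)) z.2 - generator α c' z.1 (fun y => φ (z.1, y)) z.2 =
      ∑ s, (comp c s z - comp c' s z) * compDeriv φ s z := by
  rw [generator_test, generator_test, Fintype.sum_sum_type, Fintype.sum_prod_type]
  rw [add_sub_add_comm, ← mul_sub, ← Finset.sum_sub_distrib, ← Finset.sum_sub_distrib,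
    Finset.mul_sum]
  congr 1
  · refine Finset.sum_congr rfl fun i _ => ?_
    rw [← Finset.sum_sub_distrib, Finset.mul_sum]
    refine Finset.sum_congr rfl fun j _ => ?_
    simp only [comp, compDeriv, Sum.elim_inl]
    ring
  · refine Finset.sum_congr rfl fun i _ => ?_
    simp only [comp, compDeriv, Sum.elim_inr]
    ring

theorem memLp_mul_compDeriv {p : SpaceTime n → ℝ} (hp : Continuous p) (φ : 𝓓(slab n T, ℝ))
    (s : CompIndex n) : MemLp (fun z => p z * compDeriv φ s z) 2 (slabMeasure n T) := by
  have key : ∀ χ : 𝓓(slab n T, ℝ), MemLp (fun z => p z * χ z) 2 (slabMeasure n T) := fun χ =>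
    ((hp.mul χ.continuous).memLp_of_hasCompactSupport χ.hasCompactSupport.mul_left).restrict _
  rcases s with ⟨i, j⟩ | i
  · refine ((key (testDeriv i.succ (testDeriv j.succ φ))).const_mul (1 / 2)).ae_eq
      (Eventually.of_forall fun z => ?_)
    exact mul_left_comm _ _ _
  · exact key (testDeriv i.succ φ)

/-- The product of the continuous `p` with a derivative of `φ` is continuous with compact support,
hence in $L^2$. The integrals thus differ from their limit by pairings of $L^2$-convergent
components with fixed $L^2$ functions. -/
theorem tendsto_integral_generator {α κ : ℝ} {p : SpaceTime n → ℝ}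
    (hp : Continuous p) {C : ℕ → Coeff n} {c : Coeff n}
    {U : ℕ → CompIndex n → Lp ℝ 2 (slabMeasure n T)} {W : CompIndex n → Lp ℝ 2 (slabMeasure n T)}
    (hU : ∀ k s, comp (C k) s =ᵐ[slabMeasure n T] fun z => κ⁻¹ * U k s z)
    (hW : ∀ s, comp c s =ᵐ[slabMeasure n T] fun z => κ⁻¹ * W s z)
    (h : ∀ s, Tendsto (fun k => U k s) atTop (𝓝 (W s))) (φ : 𝓓(slab n T, ℝ))
    (hC : ∀ k, Integrable (fun z => p z * generator α (C k) z.1 (fun y => φ (z.1, y)) z.2)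
      (slabMeasure n T))
    (hc : Integrable (fun z => p z * generator α c z.1 (fun y => φ (z.1, y)) z.2)
      (slabMeasure n T)) :
    Tendsto (fun k => ∫ z, p z * generator α (C k) z.1 (fun y => φ (z.1, y)) z.2
      ∂(slabMeasure n T)) atTop
      (𝓝 (∫ z, p z * generator α c z.1 (fun y => φ (z.1, y)) z.2 ∂(slabMeasure n T))) := by
  have hX := memLp_mul_compDeriv hp φ
  have hi : ∀ (V : Lp ℝ 2 (slabMeasure n T)) s,
      Integrable (fun z => V z * (p z * compDeriv φ s z)) (slabMeasure n T) := fun V s =>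
    (Lp.memLp V).integrable_mul (hX s)
  have key : ∀ k, ∫ z, p z * generator α (C k) z.1 (fun y => φ (z.1, y)) z.2 ∂(slabMeasure n T) =
      ∫ z, p z * generator α c z.1 (fun y => φ (z.1, y)) z.2 ∂(slabMeasure n T) +
      ∑ s, κ⁻¹ * (∫ z, U k s z * (p z * compDeriv φ s z) ∂(slabMeasure n T) -
        ∫ z, W s z * (p z * compDeriv φ s z) ∂(slabMeasure n T)) := fun k => by
    rw [← sub_eq_iff_eq_add', ← integral_sub (hC k) hc]
    have e : ∀ᵐ z ∂(slabMeasure n T), p z * generator α (C k) z.1 (fun y => φ (z.1, y)) z.2 -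
        p z * generator α c z.1 (fun y => φ (z.1, y)) z.2 =
        ∑ s, κ⁻¹ * (U k s z * (p z * compDeriv φ s z) - W s z * (p z * compDeriv φ s z)) := by
      filter_upwards [ae_all_iff.2 (hU k), ae_all_iff.2 hW] with z h1 h2
      rw [← mul_sub, generator_sub, Finset.mul_sum]
      refine Finset.sum_congr rfl fun s _ => ?_
      rw [h1, h2]
      ring
    rw [integral_congr_ae e]
    refine (integral_finsetSum _ fun s _ => ((hi (U k s) s).sub (hi (W s) s)).const_mul κ⁻¹).trans
      (Finset.sum_congr rfl fun s _ => ?_)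
    simp only [Pi.sub_apply]
    rw [integral_const_mul, integral_sub (hi _ s) (hi _ s)]
  simp only [key]
  have h0 : Tendsto (fun k => ∑ s,
      κ⁻¹ * (∫ z, U k s z * (p z * compDeriv φ s z) ∂(slabMeasure n T) -
        ∫ z, W s z * (p z * compDeriv φ s z) ∂(slabMeasure n T))) atTop
        (𝓝 (∑ s : CompIndex n, κ⁻¹ * (∫ z, W s z * (p z * compDeriv φ s z) ∂(slabMeasure n T) -
        ∫ z, W s z * (p z * compDeriv φ s z) ∂(slabMeasure n T)))) :=
    tendsto_finsetSum _ fun s _ =>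
      ((tendsto_integral_mul (h s) (hX s)).sub tendsto_const_nhds).const_mul _
  simp only [sub_self, mul_zero, Finset.sum_const_zero] at h0
  simpa using tendsto_const_nhds.add h0

/-- A limit in `L²` of feasible coefficients has a feasible representative. -/
theorem exists_feasible_limit {m : ℕ} {Rstar κ : ℝ} {C : ℕ → Coeff n}
    (hC : ∀ k, C k ∈ feasibleSet n m T Rstar)
    {U : ℕ → CompIndex n → Lp ℝ 2 (slabMeasure n T)} {W : CompIndex n → Lp ℝ 2 (slabMeasure n T)}
    (hU : ∀ k s, comp (C k) s =ᵐ[slabMeasure n T] fun z => κ⁻¹ * U k s z)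
    (h : ∀ s, Tendsto (fun k => U k s) atTop (𝓝 (W s)))
    (hW : ∀ s, MemSobolev T (sobolevExponent n m) fun z => κ⁻¹ * W s z) :
    ∃ c ∈ feasibleSet n m T Rstar,
      ∀ s, comp c s =ᵐ[slabMeasure n T] fun z => κ⁻¹ * W s z := by
  classical
  obtain ⟨ns, -, hns⟩ := exists_subseq_tendsto_ae h Finset.univ
  have hns' := ae_all_iff.2 fun s => hns s (Finset.mem_univ s)
  have hU' := ae_all_iff.2 fun k => ae_all_iff.2 (hU k)
  let A : SpaceTime n → Matrix (Fin n) (Fin n) ℝ := fun z =>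
    Matrix.of fun i j => κ⁻¹ * W (.inl (i, j)) z
  let B : SpaceTime n → State n := fun z => WithLp.toLp 2 fun i => κ⁻¹ * W (.inr i) z
  -- Feasibility is demanded at every point, including the faces $t=0,T$, while the limit satisfies
  -- it only almost everywhere. Setting the coefficients to zero off `good` changes a null set of
  -- the slab and makes both constraints hold everywhere.
  let good : Set (SpaceTime n) := {z | (A z).PosSemidef ∧ (Rstar < ‖z.2‖ → A z = 0 ∧ B z = 0)}
  have hgood : ∀ᵐ z ∂(slabMeasure n T), z ∈ good := by
    filter_upwards [hns', hU', ae_restrict_mem (slab n T).isOpen.measurableSet] with z h1 h2 h3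
    have ht : z.1 ∈ Icc 0 T := Ioo_subset_Icc_self h3.1
    have hlim : ∀ s, Tendsto (fun k => comp (C (ns k)) s z) atTop (𝓝 (κ⁻¹ * W s z)) := fun s => by
      simp only [h2]
      exact (h1 s).const_mul _
    refine ⟨posSemidef_of_tendsto (fun k => (hC (ns k)).1.2 z.1 ht z.2)
      fun i j => hlim (.inl (i, j)), fun hz => ?_⟩
    have h0 : ∀ k, (C k).1 z = 0 ∧ (C k).2 z = 0 := fun k => by
      have := image_eq_zero_of_notMem_tsupport (x := z.2)
        (f := fun y => ((C k).1 (z.1, y), (C k).2 (z.1, y)))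
        fun hh => absurd ((hC k).2 z.1 ht hh) (by simpa using hz)
      exact Prod.mk_eq_zero.1 this
    have h0' : ∀ k s, comp (C k) s z = 0 := by
      rintro k (⟨i, j⟩ | i)
      · exact congrFun (congrFun (h0 k).1 i) j
      · exact congrArg (fun v : State n => v i) (h0 k).2
    have h4 : ∀ s, κ⁻¹ * W s z = 0 := fun s => by
      have := hlim s
      simp only [h0'] at this
      exact tendsto_nhds_unique this tendsto_const_nhds
    exact ⟨by ext i j; exact h4 _, by ext i; exact h4 _⟩
  let c : Coeff n := (good.indicator A, good.indicator B)
  have hc : ∀ s, comp c s =ᵐ[slabMeasure n T] fun z => κ⁻¹ * W s z := by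
    rintro (⟨i, j⟩ | i)
    · filter_upwards [hgood] with z hz
      change good.indicator A z i j = _
      rw [indicator_of_mem hz]
      rfl
    · filter_upwards [hgood] with z hz
      change good.indicator B z i = _
      rw [indicator_of_mem hz]
  refine ⟨c, ⟨⟨mem_coeffSpace_iff.2 fun s γ hγ => ?_, fun t _ y => ?_⟩, fun t _ => ?_⟩, hc⟩
  · obtain ⟨g, hg⟩ := hW s γ hγ
    exact ⟨g, hg.congr (hc s).symm (EventuallyEq.refl _ _)⟩
  · by_cases hz : (t, y) ∈ good
    · change (good.indicator A (t, y)).PosSemidef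
      rw [indicator_of_mem hz]
      exact hz.1
    · change (good.indicator A (t, y)).PosSemidef
      rw [indicator_of_notMem hz]
      exact Matrix.PosSemidef.zero
  · refine closure_minimal (fun y hy => ?_) Metric.isClosed_closedBall
    by_contra hy'
    apply hy
    rw [Prod.mk_eq_zero]
    change good.indicator A (t, y) = 0 ∧ good.indicator B (t, y) = 0
    by_cases hz : (t, y) ∈ good
    · rw [indicator_of_mem hz, indicator_of_mem hz]
      exact hz.2 (by simpa using hy')
    · rw [indicator_of_notMem hz, indicator_of_notMem hz]
      exact ⟨rfl, rfl⟩

/-- Closedness of the image of the feasible set. The dual generator of the limit coefficients exists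
by `hq`; it remains only to see that it is the limit of the given ones, and for this it is enough to
pass to the limit in the pairings with each test function. -/
theorem exists_isGraph_of_tendsto {m : ℕ} {α κ Rstar : ℝ} (hκ : κ ≠ 0) {p g : SpaceTime n → ℝ}
    (hp : Continuous p) (hg : MemLp g 2 (slabMeasure n T))
    (hq : ∀ c ∈ feasibleSet n m T Rstar, ∃ q, IsDualGenerator T α c p q)
    {C : ℕ → Coeff n} {V : ℕ → GraphSpace n (sobolevExponent n m) T}
    {v : GraphSpace n (sobolevExponent n m) T} (hC : ∀ k, C k ∈ feasibleSet n m T Rstar)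
    (hV : ∀ k, IsGraph α κ p g (sobolevExponent n m) (C k) (V k))
    (h : Tendsto V atTop (𝓝 v)) :
    ∃ c ∈ feasibleSet n m T Rstar, IsGraph α κ p g (sobolevExponent n m) c v := by
  have hlim : ∀ i, Tendsto (fun k => V k i) atTop (𝓝 (v i)) := fun i =>
    ((PiLp.continuous_apply 2 _ i).tendsto v).comp h
  let z0 : multiIndices n (sobolevExponent n m) := ⟨0, zero_mem_multiIndices n _⟩
  have hU : ∀ k s, comp (C k) s =ᵐ[slabMeasure n T] fun z => κ⁻¹ * V k (some (s, z0)) z :=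
    fun k s => (hV k).comp_ae_eq hκ s
  have hder : ∀ s (γ : multiIndices n (sobolevExponent n m)),
      HasWeakDeriv T (γ : Fin (n + 1) → ℕ) (v (some (s, z0))) (v (some (s, γ))) := fun s γ =>
    hasWeakDeriv_of_tendsto (hlim _) (hlim _) fun k => ((hV k).2 s γ).congr
      (hasWeakDeriv_zero_index ((hV k).2 s z0)) (EventuallyEq.refl _ _)
  obtain ⟨c, hc, hcW⟩ := exists_feasible_limit hC (U := fun k s => V k (some (s, z0)))
    (W := fun s => v (some (s, z0))) hU (fun s => hlim _)
    fun s γ hγ => ⟨_, (hder s ⟨γ, hγ⟩).const_mul κ⁻¹⟩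
  refine ⟨c, hc, ?_, fun s γ => ?_⟩
  · obtain ⟨q, hqc⟩ := hq c hc
    refine hqc.congr (ae_eq_of_integral_test (locallyIntegrableOn_of_memLp hqc.1)
      (locallyIntegrableOn_of_memLp (hg.sub (Lp.memLp (v none)))) fun φ => ?_)
    rw [(hqc.2 φ).2]
    have h1 := tendsto_integral_generator hp hU hcW (fun s => hlim _) φ
      (fun k => ((hV k).1.2 φ).1) (hqc.2 φ).1
    have hs : ∀ w : Lp ℝ 2 (slabMeasure n T), ∫ z, (g z - w z) * φ z ∂(slabMeasure n T) =
        ∫ z, g z * φ z ∂(slabMeasure n T) - ∫ z, w z * φ z ∂(slabMeasure n T) := fun w => by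
      rw [← integral_sub (integrable_mul_test (locallyIntegrableOn_of_memLp hg) φ)
        (integrable_mul_test (locallyIntegrableOn_of_memLp (Lp.memLp w)) φ)]
      simp only [sub_mul]
    have h2 : Tendsto (fun k => ∫ z, (g z - V k none z) * φ z ∂(slabMeasure n T)) atTop
        (𝓝 (∫ z, (g z - v none z) * φ z ∂(slabMeasure n T))) := by
      simp only [hs]
      exact (tendsto_integral_mul (hlim none) (memLp_test φ 2)).const_sub _
    exact tendsto_nhds_unique h1 (h2.congr fun k => ((hV k).1.2 φ).2)
  · refine (hder s γ).congr ?_ (EventuallyEq.refl _ _)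
    filter_upwards [hcW s] with z hz
    rw [hz, mul_inv_cancel_left₀ hκ]

/-- Existence and uniqueness of the minimizer of the learning problem. -/
theorem existsUnique_minimizer {m : ℕ} {α lam Rstar : ℝ} (hlam : 0 < lam) {p g : SpaceTime n → ℝ}
    (hp : Continuous p) (hg : HasWeakDeriv T (timeIndex n) p g)
    (hq : ∀ c ∈ feasibleSet n m T Rstar, ∃ q, IsDualGenerator T α c p q) :
    ∃ c ∈ feasibleSet n m T Rstar,
      IsMinOn (learningCost m T α lam p) (feasibleSet n m T Rstar) c ∧
      ∀ c' ∈ feasibleSet n m T Rstar,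
        IsMinOn (learningCost m T α lam p) (feasibleSet n m T Rstar) c' →
        c'.1 =ᵐ[slabMeasure n T] c.1 ∧ c'.2 =ᵐ[slabMeasure n T] c.2 := by
  have hκ : Real.sqrt lam ≠ 0 := (Real.sqrt_pos.2 hlam).ne'
  set r := sobolevExponent n m with hr
  let K : Set (GraphSpace n r T) :=
    {v | ∃ c ∈ feasibleSet n m T Rstar, IsGraph α (Real.sqrt lam) p g r c v}
  have hex : ∀ c ∈ feasibleSet n m T Rstar, ∃ v, IsGraph (T := T) α (Real.sqrt lam) p g r c v :=
    fun c hc => exists_isGraph hg.2.1 hc.1.1 (hq c hc)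
  have hne : K.Nonempty := by
    obtain ⟨v, hv⟩ := hex 0 (zero_mem_feasibleSet n m T Rstar)
    exact ⟨v, 0, zero_mem_feasibleSet n m T Rstar, hv⟩
  have hclosed : IsClosed K := by
    refine IsSeqClosed.isClosed fun V v hV hv => ?_
    choose C hC hCV using hV
    exact exists_isGraph_of_tendsto hκ hp hg.2.1 hq hC hCV hv
  have hconv : Convex ℝ K := by
    rintro v ⟨c, hc, hcv⟩ v' ⟨c', hc', hcv'⟩ a b ha hb hab
    exact ⟨_, feasibleSet_convex_comb ha hb hc hc', hcv.convex_comb hab hcv'⟩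
  -- `v` is the point of $K$ nearest to the origin. Its variational inequality gives
  -- $\|v\|^2\le\langle v,w\rangle$ on $K$, hence $\|v-w\|^2\le\|w\|^2-\|v\|^2$, which proves both
  -- minimality and uniqueness.
  obtain ⟨v, hvK, hv⟩ := exists_norm_eq_iInf_of_complete_convex hne hclosed.isComplete hconv 0
  have hinner := (norm_eq_iInf_iff_real_inner_le_zero hconv hvK).1 hv
  have hle : ∀ w ∈ K, ‖v‖ ^ 2 ≤ inner ℝ v w := fun w hw => by
    have := hinner w hw
    rw [zero_sub, inner_neg_left, inner_sub_right, real_inner_self_eq_norm_sq] at this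
    linarith
  obtain ⟨c, hc, hcv⟩ := hvK
  refine ⟨c, hc, fun c' hc' => ?_, fun c' hc' hmin => ?_⟩
  · obtain ⟨w, hw⟩ := hex c' hc'
    change learningCost m T α lam p c ≤ learningCost m T α lam p c'
    rw [hcv.learningCost_eq hlam hg, hw.learningCost_eq hlam hg]
    have h1 := hle w ⟨c', hc', hw⟩
    have h2 := norm_sub_sq_real v w
    nlinarith [sq_nonneg ‖v - w‖]
  · obtain ⟨w, hw⟩ := hex c' hc'
    have h0 : learningCost m T α lam p c' ≤ learningCost m T α lam p c := hmin hc
    rw [hcv.learningCost_eq hlam hg, hw.learningCost_eq hlam hg] at h0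
    have h1 := hle w ⟨c', hc', hw⟩
    have h2 := norm_sub_sq_real v w
    have h3 : ‖v - w‖ ^ 2 = 0 := le_antisymm (by linarith) (sq_nonneg _)
    have h4 : v = w := sub_eq_zero.1 (norm_eq_zero.1 (pow_eq_zero_iff (two_ne_zero)|>.1 h3))
    subst h4
    exact ae_eq_of_comp fun s => (hw.comp_ae_eq hκ s).trans (hcv.comp_ae_eq hκ s).symm

/-! ### The Matérn kernel is continuously differentiable -/

/-- The kink of $|u|$ at the origin is harmless because $F'(0)=0$; the convention that the sign of
$0$ is $0$ makes one formula valid everywhere. -/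
theorem hasDerivAt_comp_abs {F F' : ℝ → ℝ} (hF : ∀ r, HasDerivAt F (F' r) r) (h0 : F' 0 = 0)
    (u : ℝ) : HasDerivAt (fun u => F |u|) (Real.sign u * F' |u|) u := by
  rcases lt_trichotomy u 0 with hu | rfl | hu
  · have h1 : HasDerivAt (fun u => F (-u)) (F' (-u) * -1) u := (hF (-u)).comp u (hasDerivAt_neg u)
    rw [Real.sign_of_neg hu, abs_of_neg hu]
    refine (h1.congr_of_eventuallyEq ?_).congr_deriv (by ring)
    filter_upwards [Iio_mem_nhds hu] with x hx
    rw [abs_of_neg hx]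
  · have h1 := hF 0
    rw [h0, hasDerivAt_iff_isLittleO_nhds_zero] at h1
    rw [Real.sign_zero, zero_mul, hasDerivAt_iff_isLittleO_nhds_zero]
    have h2 : Tendsto (fun h : ℝ => |h|) (𝓝 0) (𝓝 0) := by
      simpa using (continuous_abs.tendsto (0 : ℝ))
    simpa [Function.comp_def] using (h1.comp_tendsto h2).trans_isBigO
      (Asymptotics.isBigO_of_le (g := fun h : ℝ => h) _ fun h => by simp)
  · rw [Real.sign_of_pos hu, abs_of_pos hu]
    refine ((hF u).congr_of_eventuallyEq ?_).congr_deriv (by ring)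
    filter_upwards [Ioi_mem_nhds hu] with x hx
    rw [abs_of_pos hx]

/-- The polynomial factor of the Matérn kernel. -/
noncomputable def maternPoly (m : ℕ) : Polynomial ℝ :=
  ∑ k ∈ Finset.range (m + 1),
    Polynomial.C (((m + k).factorial : ℝ) / (k.factorial * (m - k).factorial * 2 ^ k)) *
      Polynomial.X ^ (m - k)

theorem sobolevKernel_eq (m : ℕ) (s t : ℝ) : sobolevKernel m s t =
    Real.sqrt (Real.pi / 2) / (2 ^ m * m.factorial) * Real.exp (-|s - t|) *
      (maternPoly m).eval |s - t| := by
  simp [sobolevKernel, maternPoly, Polynomial.eval_finsetSum]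

/-- The derivative of $e^{-r}P(r)$ at $0$ is $P'(0)-P(0)$, the difference of these coefficients. The
coefficient of $X^i$ comes from the index $k=m-i$, and for $i=0,1$ both equal $(2m)!/(m!\,2^m)$. For
$m=0$ the equality fails, and $e^{-|u|}$ does have a corner. -/
theorem maternPoly_coeff {m : ℕ} (hm : 1 ≤ m) :
    (maternPoly m).coeff 1 = (maternPoly m).coeff 0 := by
  obtain ⟨l, rfl⟩ : ∃ l, m = l + 1 := ⟨m - 1, by omega⟩
  have h : ∀ i, i ≤ l + 1 → (maternPoly (l + 1)).coeff i =
      ((l + 1 + (l + 1 - i)).factorial : ℝ) /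
        ((l + 1 - i).factorial * (i.factorial : ℝ) * 2 ^ (l + 1 - i)) := by
    intro i hi
    rw [maternPoly, Polynomial.finsetSum_coeff, Finset.sum_eq_single (l + 1 - i)]
    · rw [show l + 1 - (l + 1 - i) = i by omega, Polynomial.coeff_C_mul_X_pow, if_pos rfl]
    · intro k hk hki
      rw [Finset.mem_range] at hk
      rw [Polynomial.coeff_C_mul_X_pow, if_neg (by omega)]
    · intro hk
      exact absurd (Finset.mem_range.2 (by omega)) hk
  rw [h 1 (by omega), h 0 (by omega)]
  simp only [Nat.add_sub_cancel, Nat.sub_zero, Nat.factorial_one, Nat.factorial_zero, Nat.cast_one,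
    mul_one]
  rw [show l + 1 + (l + 1) = (l + 1 + l) + 1 by ring, Nat.factorial_succ (l + 1 + l),
    Nat.factorial_succ l, pow_succ]
  have : (l.factorial : ℝ) ≠ 0 := by positivity
  push_cast
  field_simp
  ring

/-- The derivative of the radial profile of the Matérn kernel. -/
noncomputable def maternDeriv (m : ℕ) (r : ℝ) : ℝ :=
  Real.sqrt (Real.pi / 2) / (2 ^ m * m.factorial) * Real.exp (-r) *
    ((maternPoly m).derivative.eval r - (maternPoly m).eval r)

theorem hasDerivAt_sobolevKernel {m : ℕ} (hm : 1 ≤ m) (s t : ℝ) :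
    HasDerivAt (fun t => sobolevKernel m t s) (Real.sign (t - s) * maternDeriv m |t - s|) t := by
  simp only [sobolevKernel_eq]
  have hF : ∀ r, HasDerivAt (fun r => Real.sqrt (Real.pi / 2) / (2 ^ m * m.factorial) *
      Real.exp (-r) * (maternPoly m).eval r) (maternDeriv m r) r := fun r => by
    have h1 : HasDerivAt (fun r : ℝ => Real.exp (-r)) (Real.exp (-r) * -1) r :=
      (Real.hasDerivAt_exp (-r)).comp r (hasDerivAt_neg r)
    refine ((h1.const_mul _).mul ((maternPoly m).hasDerivAt r)).congr_deriv ?_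
    rw [maternDeriv]
    ring
  have h0 : maternDeriv m 0 = 0 := by
    rw [maternDeriv, ← Polynomial.coeff_zero_eq_eval_zero, ← Polynomial.coeff_zero_eq_eval_zero,
      Polynomial.coeff_derivative, Nat.cast_zero, zero_add, zero_add, mul_one, maternPoly_coeff hm,
      sub_self, mul_zero]
  have h2 := hasDerivAt_comp_abs hF h0 (t - s)
  exact h2.comp_sub_const t s

theorem continuous_maternDeriv (m : ℕ) : Continuous (maternDeriv m) := by
  unfold maternDeriv
  fun_prop

theorem measurable_sign : Measurable Real.sign := by
  unfold Real.sign
  exact Measurable.ite measurableSet_Iio measurable_const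
    (Measurable.ite measurableSet_Ioi measurable_const measurable_const)

/-- The derivative of `interpCoeff`. -/
noncomputable def interpCoeffDeriv (m : ℕ) (T : ℝ) {M : ℕ} (l : Fin M) (t : ℝ) : ℝ :=
  ∑ k, (gram m T M)⁻¹ l k *
    (Real.sign (t - sampleTime T k) * maternDeriv m |t - sampleTime T k|)

theorem hasDerivAt_interpCoeff {m : ℕ} (hm : 1 ≤ m) (T : ℝ) {M : ℕ} (l : Fin M) (t : ℝ) :
    HasDerivAt (interpCoeff m T l) (interpCoeffDeriv m T l t) t := by
  have : HasDerivAt (fun t => ∑ k, (gram m T M)⁻¹ l k * sobolevKernel m t (sampleTime T k))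
      (interpCoeffDeriv m T l t) t :=
    HasDerivAt.fun_sum fun k _ => (hasDerivAt_sobolevKernel hm (sampleTime T k) t).const_mul _
  exact this

theorem continuous_interpCoeff {m : ℕ} (hm : 1 ≤ m) (T : ℝ) {M : ℕ} (l : Fin M) :
    Continuous (interpCoeff m T l) :=
  continuous_iff_continuousAt.2 fun t => (hasDerivAt_interpCoeff hm T l t).continuousAt

theorem measurable_interpCoeffDeriv (m : ℕ) (T : ℝ) {M : ℕ} (l : Fin M) :
    Measurable (interpCoeffDeriv m T l) := by
  refine Finset.measurable_fun_sum _ fun k _ => Measurable.const_mul (Measurable.mul ?_ ?_) _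
  · exact measurable_sign.comp (measurable_id.sub_const _)
  · exact ((continuous_maternDeriv m).comp
      (continuous_abs.comp (continuous_id.sub continuous_const))).measurable

theorem interpCoeffDeriv_bounded (m : ℕ) (T : ℝ) {M : ℕ} (l : Fin M) :
    ∃ C, ∀ t ∈ Icc 0 T, ‖interpCoeffDeriv m T l t‖ ≤ C := by
  have hc : Continuous fun t =>
      ∑ k, |(gram m T M)⁻¹ l k| * |maternDeriv m (|t - sampleTime T k|)| := by
    have := continuous_maternDeriv m
    fun_prop
  obtain ⟨C, hC⟩ := exists_bound_Icc hc T
  refine ⟨C, fun t ht => le_trans ?_ ((le_abs_self _).trans (hC t ht))⟩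
  refine (norm_sum_le _ _).trans (Finset.sum_le_sum fun k _ => ?_)
  rw [norm_mul, norm_mul, Real.norm_eq_abs, Real.norm_eq_abs, Real.norm_eq_abs]
  refine mul_le_mul_of_nonneg_left (mul_le_of_le_one_left (abs_nonneg _) ?_) (abs_nonneg _)
  rcases Real.sign_apply_eq (t - sampleTime T k) with h | h | h <;> simp [h]

/-! ### The model density -/

theorem IsBandLimited.const_mul {ψ : State n → ℝ} (h : IsBandLimited ψ) (r : ℝ) :
    IsBandLimited fun x => r * ψ x := by
  obtain ⟨f, hf, rfl⟩ := h
  refine ⟨_, hf.continuous_mul (g := fun _ => (r : ℂ)) continuous_const, ?_⟩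
  funext x
  rw [Real.fourier_eq']
  simp only [smul_eq_mul, mul_left_comm _ (r : ℂ)]
  rw [integral_const_mul, Complex.re_ofReal_mul, Real.fourier_eq']
  rfl

theorem IsBandSymbol.add {f g : State n → ℂ} (hf : IsBandSymbol f) (hg : IsBandSymbol g) :
    IsBandSymbol fun ξ => f ξ + g ξ := by
  obtain ⟨hm, C, r, h⟩ := hf
  obtain ⟨hm', C', r', h'⟩ := hg
  refine ⟨hm.add hm', C + C', max r r', fun ξ => ⟨(norm_add_le _ _).trans
    (add_le_add (h ξ).1 (h' ξ).1), fun hr => ?_⟩⟩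
  simp only [(h ξ).2 ((le_max_left _ _).trans_lt hr), (h' ξ).2 ((le_max_right _ _).trans_lt hr),
    add_zero]

theorem IsBandLimited.add {ψ χ : State n → ℝ} (h : IsBandLimited ψ) (h' : IsBandLimited χ) :
    IsBandLimited fun x => ψ x + χ x := by
  obtain ⟨f, hf, rfl⟩ := h
  obtain ⟨g, hg, rfl⟩ := h'
  refine ⟨_, hf.add hg, ?_⟩
  funext x
  have h1 := (Real.fourierIntegral_convergent_iff (f := f) x).2
    (memLp_one_iff_integrable.1 (hf.memLp 1))
  have h2 := (Real.fourierIntegral_convergent_iff (f := g) x).2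
    (memLp_one_iff_integrable.1 (hg.memLp 1))
  simp only [Real.fourier_eq]
  rw [← Complex.add_re, ← integral_add h1 h2]
  simp only [smul_add]

theorem isBandLimited_zero : IsBandLimited fun _ : State n => (0 : ℝ) :=
  ⟨fun _ => 0, ⟨aestronglyMeasurable_const, 0, 0, fun ξ => ⟨by simp, fun _ => rfl⟩⟩,
    funext fun x => by simp [Real.fourier_eq]⟩

theorem IsBandLimited.sum {ι : Type*} (s : Finset ι) {ψ : ι → State n → ℝ}
    (h : ∀ i ∈ s, IsBandLimited (ψ i)) : IsBandLimited fun x => ∑ i ∈ s, ψ i x := by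
  classical
  induction s using Finset.induction_on with
  | empty => simpa using isBandLimited_zero
  | insert a s ha ih =>
    simp only [Finset.sum_insert ha]
    exact (h a (Finset.mem_insert_self a s)).add
      (ih fun i hi => h i (Finset.mem_insert_of_mem hi))

theorem isBandLimited_average {R : ℝ} (hρ : IsBandLimited (rho n R)) {N : ℕ}
    (X : Fin N → State n) : IsBandLimited fun x => 1 / (N : ℝ) * ∑ j, rho n R (x - X j) :=
  (IsBandLimited.sum Finset.univ fun j _ => hρ.comp_sub (X j)).const_mul _

theorem isSeparatedDensity_modelDensity {m : ℕ} (hm : 1 ≤ m) {R : ℝ}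
    (hρ : IsBandLimited (rho n R)) (T : ℝ) {M N : ℕ} (X : Fin M → Fin N → State n) :
    IsSeparatedDensity (modelDensity m T R X) :=
  ⟨M, fun l => interpCoeff m T l, fun l x => 1 / (N : ℝ) * ∑ j, rho n R (x - X l j),
    fun l => continuous_interpCoeff hm T l, fun l => isBandLimited_average hρ (X l), rfl⟩

theorem IsSeparatedDensity.continuous {p : SpaceTime n → ℝ} (hp : IsSeparatedDensity p) :
    Continuous p := by
  obtain ⟨L, c, ψ, hc, hψ, rfl⟩ := hp
  exact continuous_finsetSum _ fun l _ => ((hc l).comp continuous_fst).mul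
    ((hψ l).contDiff.continuous.comp continuous_snd)

theorem hasWeakDeriv_modelDensity {m : ℕ} (hm : 1 ≤ m) {R : ℝ}
    (hρ : IsBandLimited (rho n R)) (T : ℝ) {M N : ℕ} (X : Fin M → Fin N → State n) :
    HasWeakDeriv T (timeIndex n) (modelDensity m T R X)
      fun z => ∑ l, interpCoeffDeriv m T l z.1 * (1 / (N : ℝ) * ∑ j, rho n R (z.2 - X l j)) :=
  HasWeakDeriv.sum Finset.univ fun l _ =>
    hasWeakDeriv_time_separated (hasDerivAt_interpCoeff hm T l)
    (measurable_interpCoeffDeriv m T l) (interpCoeffDeriv_bounded m T l)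
    (isBandLimited_average hρ (X l))

/-! ### Moments of the ball -/

theorem integrable_gaussian (n : ℕ) {b : ℝ} (hb : 0 < b) :
    Integrable fun ξ : State n => Real.exp (-b * ‖ξ‖ ^ 2) := by
  -- The Bochner integral of a nonintegrable function is $0$ by convention, so the known positive
  -- value implies integrability.
  refine Integrable.of_integral_ne_zero ?_
  rw [GaussianFourier.integral_rexp_neg_mul_sq_norm hb]
  positivity

theorem integrable_inner_pow_mul_gaussian (x : State n) (j : ℕ) :
    Integrable fun ξ : State n => inner ℝ ξ x ^ j * Real.exp (-‖ξ‖ ^ 2) := by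
  -- The constant combines $s^j\le j!\,e^s$ with $s-s^2\le\frac12-\frac12s^2$, which is
  -- $(s-1)^2\ge0$, at $s=\|\xi\|$.
  refine ((integrable_gaussian n (b := 1 / 2) (by norm_num)).const_mul
    (‖x‖ ^ j * (j.factorial * Real.exp (1 / 2)))).mono' (by fun_prop)
    (Eventually.of_forall fun ξ => ?_)
  have h1 : |inner ℝ ξ x| ^ j ≤ (‖ξ‖ * ‖x‖) ^ j :=
    pow_le_pow_left₀ (abs_nonneg _) (abs_real_inner_le_norm ξ x) j
  have h2 : ‖ξ‖ ^ j ≤ j.factorial * Real.exp ‖ξ‖ := by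
    have := Real.pow_div_factorial_le_exp ‖ξ‖ (norm_nonneg _) j
    rwa [div_le_iff₀' (by positivity)] at this
  have h3 : Real.exp ‖ξ‖ * Real.exp (-‖ξ‖ ^ 2) ≤
      Real.exp (1 / 2) * Real.exp (-(1 / 2) * ‖ξ‖ ^ 2) := by
    rw [← Real.exp_add, ← Real.exp_add]
    exact Real.exp_le_exp.2 (by nlinarith [sq_nonneg (‖ξ‖ - 1)])
  rw [norm_mul, norm_pow, Real.norm_eq_abs, Real.norm_of_nonneg (Real.exp_nonneg _)]
  calc |inner ℝ ξ x| ^ j * Real.exp (-‖ξ‖ ^ 2)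
      ≤ (‖ξ‖ * ‖x‖) ^ j * Real.exp (-‖ξ‖ ^ 2) := by gcongr
    _ = ‖x‖ ^ j * (‖ξ‖ ^ j * Real.exp (-‖ξ‖ ^ 2)) := by rw [mul_pow]; ring
    _ ≤ ‖x‖ ^ j * (j.factorial * Real.exp ‖ξ‖ * Real.exp (-‖ξ‖ ^ 2)) := by gcongr
    _ ≤ ‖x‖ ^ j * (j.factorial * (Real.exp (1 / 2) * Real.exp (-(1 / 2) * ‖ξ‖ ^ 2))) := by
        rw [mul_assoc (j.factorial : ℝ)]; gcongr
    _ = _ := by ring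

/-- Integration by parts in the direction `x`, where the Gaussian has derivative
$-2\langle\xi,x\rangle e^{-\|\xi\|^2}$. -/
theorem integral_inner_pow_succ_mul_gaussian (x : State n) (j : ℕ) :
    ∫ ξ : State n, inner ℝ ξ x ^ (j + 2) * Real.exp (-‖ξ‖ ^ 2) =
      (j + 1) / 2 * ‖x‖ ^ 2 * ∫ ξ : State n, inner ℝ ξ x ^ j * Real.exp (-‖ξ‖ ^ 2) := by
  have hf : ∀ ξ : State n, HasFDerivAt (fun ξ : State n => inner ℝ ξ x ^ (j + 1))
      (((j + 1 : ℕ) * inner ℝ ξ x ^ j : ℝ) • innerSL ℝ x) ξ := fun ξ => by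
    have h1 : HasFDerivAt (fun ξ : State n => inner ℝ ξ x) (innerSL ℝ x) ξ := by
      have := (innerSL ℝ x).hasFDerivAt (x := ξ)
      refine this.congr_of_eventuallyEq (Eventually.of_forall fun ζ => ?_)
      exact real_inner_comm x ζ
    simpa using h1.pow (j + 1)
  have hg : ∀ ξ : State n, HasFDerivAt (fun ξ : State n => Real.exp (-‖ξ‖ ^ 2))
      (Real.exp (-‖ξ‖ ^ 2) • -((2 : ℕ) • (innerSL ℝ ξ : State n →L[ℝ] ℝ))) ξ := fun ξ =>
    ((hasStrictFDerivAt_norm_sq ξ).hasFDerivAt.neg).exp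
  have hd : ∀ ξ : State n, (Real.exp (-‖ξ‖ ^ 2) • -((2 : ℕ) • (innerSL ℝ ξ : State n →L[ℝ] ℝ))) x =
      -2 * (inner ℝ ξ x * Real.exp (-‖ξ‖ ^ 2)) := fun ξ => by
    simp
    ring
  have hd' : ∀ ξ : State n,
      ((((j + 1 : ℕ) * inner ℝ ξ x ^ j : ℝ) • innerSL ℝ x) : State n →L[ℝ] ℝ) x =
      (j + 1) * ‖x‖ ^ 2 * inner ℝ ξ x ^ j := fun ξ => by
    simp
    ring
  have i1 := integrable_inner_pow_mul_gaussian x (j + 1)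
  have i2 := (integrable_inner_pow_mul_gaussian x (j + 2)).const_mul (-2)
  have i3 := (integrable_inner_pow_mul_gaussian x j).const_mul ((j + 1) * ‖x‖ ^ 2)
  have key := integral_bilinear_hasFDerivAt_right_eq_neg_left_of_integrable (μ := volume)
    (B := ContinuousLinearMap.mul ℝ ℝ) (v := x) (f := fun ξ : State n => inner ℝ ξ x ^ (j + 1))
    (g := fun ξ : State n => Real.exp (-‖ξ‖ ^ 2))
    (f' := fun ξ => ((j + 1 : ℕ) * inner ℝ ξ x ^ j : ℝ) • innerSL ℝ x)
    (g' := fun ξ => Real.exp (-‖ξ‖ ^ 2) • -((2 : ℕ) • (innerSL ℝ ξ : State n →L[ℝ] ℝ)))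
    (i3.congr (Eventually.of_forall fun ξ => by
      simp only [ContinuousLinearMap.mul_apply', hd']; ring))
    (i2.congr (Eventually.of_forall fun ξ => by
      simp only [ContinuousLinearMap.mul_apply', hd]; ring))
    i1 (fun ξ _ => hf ξ) (fun ξ _ => hg ξ)
  simp only [ContinuousLinearMap.mul_apply', hd, hd'] at key
  have e1 : ∀ ξ : State n, inner ℝ ξ x ^ (j + 1) * (-2 * (inner ℝ ξ x * Real.exp (-‖ξ‖ ^ 2))) =
      -2 * (inner ℝ ξ x ^ (j + 2) * Real.exp (-‖ξ‖ ^ 2)) := fun ξ => by ring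
  have e2 : ∀ ξ : State n, (j + 1) * ‖x‖ ^ 2 * inner ℝ ξ x ^ j * Real.exp (-‖ξ‖ ^ 2) =
      (j + 1) * ‖x‖ ^ 2 * (inner ℝ ξ x ^ j * Real.exp (-‖ξ‖ ^ 2)) := fun ξ => by ring
  simp only [e1, e2, integral_const_mul] at key
  linarith

/-- The recursion starts from the Gaussian mass $\pi^{n/2}$, and its factors $(2i+1)/2$ multiply to
$(2k)!/(4^kk!)$. -/
theorem integral_inner_pow_mul_gaussian (x : State n) (k : ℕ) :
    ∫ ξ : State n, inner ℝ ξ x ^ (2 * k) * Real.exp (-‖ξ‖ ^ 2) =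
      ‖x‖ ^ (2 * k) * ((2 * k).factorial / (4 ^ k * k.factorial)) * Real.pi ^ ((n : ℝ) / 2) := by
  induction k with
  | zero =>
    have := GaussianFourier.integral_rexp_neg_mul_sq_norm (V := State n) one_pos
    simpa using this
  | succ k ih =>
    rw [show 2 * (k + 1) = 2 * k + 2 by ring, integral_inner_pow_succ_mul_gaussian, ih,
      Nat.factorial_succ (2 * k + 1), Nat.factorial_succ (2 * k), Nat.factorial_succ k]
    have : (k.factorial : ℝ) ≠ 0 := by positivity
    push_cast
    field_simp
    ring

theorem setIntegral_ball_inner_pow (x : State n) (k : ℕ) {r : ℝ} (hr : 0 < r) :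
    ∫ ξ in Metric.ball (0 : State n) r, inner ℝ ξ x ^ k =
      r ^ (n + k) * ∫ ξ in Metric.ball (0 : State n) 1, inner ℝ ξ x ^ k := by
  have h := Measure.setIntegral_comp_smul_of_pos volume (fun ξ : State n => inner ℝ ξ x ^ k)
    (Metric.ball 0 1) hr
  rw [smul_unitBall_of_pos hr, finrank_euclideanSpace_fin, smul_eq_mul] at h
  simp only [inner_smul_left, mul_pow, RCLike.conj_to_real, integral_const_mul] at h
  rw [eq_inv_mul_iff_mul_eq₀ (pow_ne_zero n hr.ne')] at h
  rw [← h, pow_add]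
  ring

theorem hasDerivAt_neg_exp_neg_sq (r : ℝ) :
    HasDerivAt (fun r : ℝ => -Real.exp (-r ^ 2)) (2 * r * Real.exp (-r ^ 2)) r := by
  have h1 : HasDerivAt (fun r : ℝ => -r ^ 2) (-(2 * r)) r := by
    have := (hasDerivAt_pow 2 r).fun_neg
    simpa using this
  exact h1.exp.neg.congr_deriv (by ring)

theorem tendsto_neg_exp_neg_sq : Tendsto (fun r : ℝ => -Real.exp (-r ^ 2)) atTop (𝓝 0) := by
  have : Tendsto (fun r : ℝ => Real.exp (-r ^ 2)) atTop (𝓝 0) :=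
    Real.tendsto_exp_atBot.comp (tendsto_neg_atTop_atBot.comp (tendsto_pow_atTop two_ne_zero))
  simpa using this.neg

theorem integral_Ioi_exp_neg_sq {a : ℝ} (ha : 0 ≤ a) :
    ∫ r in Ioi a, 2 * r * Real.exp (-r ^ 2) = Real.exp (-a ^ 2) := by
  rw [integral_Ioi_of_hasDerivAt_of_nonneg' (fun r _ => hasDerivAt_neg_exp_neg_sq r)
    (fun r hr => by have := ha.trans_lt hr; positivity) tendsto_neg_exp_neg_sq]
  ring

theorem integrableOn_Ioi_exp_neg_sq {a : ℝ} (ha : 0 ≤ a) :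
    IntegrableOn (fun r => 2 * r * Real.exp (-r ^ 2)) (Ioi a) :=
  integrableOn_Ioi_deriv_of_nonneg' (fun r _ => hasDerivAt_neg_exp_neg_sq r)
    (fun r hr => by have := ha.trans_lt hr; positivity) tendsto_neg_exp_neg_sq

/-- The moments of the ball from the Gaussian moments, by integration over the level sets. -/
theorem integral_inner_pow_mul_gaussian_eq (x : State n) (k : ℕ) :
    ∫ ξ : State n, inner ℝ ξ x ^ (2 * k) * Real.exp (-‖ξ‖ ^ 2) =
      (∫ ξ in Metric.ball (0 : State n) 1, inner ℝ ξ x ^ (2 * k)) *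
        Real.Gamma (k + (n : ℝ) / 2 + 1) := by
  -- Writing $e^{-\|\xi\|^2}=\int_{\|\xi\|}^\infty 2re^{-r^2}\,dr$ and exchanging the integrals
  -- leaves, for each $r$, the moment of the ball of radius $r$, which is $r^{n+2k}$ times that of
  -- the unit ball. The remaining integral in $r$ is a Gamma value.
  set S : Set (State n × ℝ) := {z | ‖z.1‖ < z.2} with hS
  have hSm : MeasurableSet S := (isOpen_lt (by fun_prop) (by fun_prop)).measurableSet
  let H : State n → ℝ → ℝ := fun ξ r =>
    S.indicator (fun z => inner ℝ z.1 x ^ (2 * k) * (2 * z.2 * Real.exp (-z.2 ^ 2))) (ξ, r)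
  have hH : ∀ ξ r, H ξ r = (Ioi ‖ξ‖).indicator
      (fun r => inner ℝ ξ x ^ (2 * k) * (2 * r * Real.exp (-r ^ 2))) r := fun ξ r => rfl
  have hnn : ∀ ξ : State n, ∀ r, 0 ≤ H ξ r := fun ξ r => by
    rw [hH]
    refine indicator_nonneg (fun r hr => ?_) r
    have h0 : 0 < r := (norm_nonneg ξ).trans_lt hr
    have := (even_two_mul k).pow_nonneg (inner ℝ ξ x)
    positivity
  have hr1 : ∀ ξ : State n, ∫ r in Ioi 0, H ξ r =
      inner ℝ ξ x ^ (2 * k) * Real.exp (-‖ξ‖ ^ 2) := fun ξ => by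
    simp only [hH]
    rw [setIntegral_indicator measurableSet_Ioi, Ioi_inter_Ioi, sup_eq_right.2 (norm_nonneg ξ),
      integral_const_mul, integral_Ioi_exp_neg_sq (norm_nonneg ξ)]
  have hint : Integrable (Function.uncurry H)
      ((volume : Measure (State n)).prod (volume.restrict (Ioi (0 : ℝ)))) := by
    have hm : AEStronglyMeasurable (Function.uncurry H)
        ((volume : Measure (State n)).prod (volume.restrict (Ioi (0 : ℝ)))) := by
      have : Continuous fun z : State n × ℝ =>
        inner ℝ z.1 x ^ (2 * k) * (2 * z.2 * Real.exp (-z.2 ^ 2)) := by fun_prop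
      exact (this.measurable.indicator hSm).aestronglyMeasurable
    rw [integrable_prod_iff hm]
    refine ⟨Eventually.of_forall fun ξ => ?_, ?_⟩
    · change Integrable (fun r => H ξ r) _
      simp only [hH]
      exact ((integrableOn_Ioi_exp_neg_sq le_rfl).const_mul _).indicator measurableSet_Ioi
    · refine (integrable_inner_pow_mul_gaussian x (2 * k)).congr (Eventually.of_forall fun ξ => ?_)
      simp only [Function.uncurry_apply_pair, Real.norm_of_nonneg (hnn _ _), hr1]
  have hswap := integral_integral_swap hint
  simp only [hr1] at hswap
  rw [hswap]
  have hr2 : ∀ r ∈ Ioi (0 : ℝ), ∫ ξ, H ξ r =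
      (∫ ξ in Metric.ball (0 : State n) 1, inner ℝ ξ x ^ (2 * k)) *
        (2 * (r ^ ((n : ℝ) + 2 * k + 1) * Real.exp (-r ^ (2 : ℝ)))) := fun r hr => by
    have h1 : ∀ ξ, H ξ r = (Metric.ball (0 : State n) r).indicator
        (fun ξ => inner ℝ ξ x ^ (2 * k) * (2 * r * Real.exp (-r ^ 2))) ξ := fun ξ => by
      by_cases h : ‖ξ‖ < r
      · rw [indicator_of_mem (mem_ball_zero_iff.2 h), hH, indicator_of_mem (mem_Ioi.2 h)]
      · rw [indicator_of_notMem fun hh => h (mem_ball_zero_iff.1 hh), hH,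
          indicator_of_notMem fun hh => h (mem_Ioi.1 hh)]
    simp only [h1]
    rw [integral_indicator Metric.isOpen_ball.measurableSet, integral_mul_const,
      setIntegral_ball_inner_pow x (2 * k) hr]
    have h2 : r ^ ((n : ℝ) + 2 * k + 1) = r ^ (n + 2 * k) * r := by
      rw [← Real.rpow_natCast, ← Real.rpow_add_one (ne_of_gt hr)]
      push_cast
      rfl
    rw [h2, Real.rpow_two]
    ring
  rw [setIntegral_congr_fun measurableSet_Ioi hr2, integral_const_mul, integral_const_mul,
    integral_rpow_mul_exp_neg_rpow two_pos (by have : (0 : ℝ) ≤ (n : ℝ) + 2 * k := by positivity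
                                               linarith)]
  rw [show ((n : ℝ) + 2 * k + 1 + 1) / 2 = k + (n : ℝ) / 2 + 1 by ring]
  ring

theorem setIntegral_ball_inner_even_pow (x : State n) (k : ℕ) {r : ℝ} (hr : 0 < r) :
    ∫ ξ in Metric.ball (0 : State n) r, inner ℝ ξ x ^ (2 * k) =
      r ^ (n + 2 * k) * (‖x‖ ^ (2 * k) * ((2 * k).factorial / (4 ^ k * k.factorial)) *
        Real.pi ^ ((n : ℝ) / 2) / Real.Gamma (k + (n : ℝ) / 2 + 1)) := by
  have hΓ : Real.Gamma (k + (n : ℝ) / 2 + 1) ≠ 0 :=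
    (Real.Gamma_pos_of_pos (by positivity)).ne'
  rw [setIntegral_ball_inner_pow x _ hr, ← integral_inner_pow_mul_gaussian,
    integral_inner_pow_mul_gaussian_eq, mul_div_cancel_right₀ _ hΓ]

/-! ### The kernel `ρ_R` is band-limited -/

/-- The cosine series is integrated term by term, dominated on the ball by the even part of an
exponential series. The $(2k)!$ of the cosine cancels that of the moment, leaving the Bessel
coefficients. -/
theorem hasSum_integral_cos (x : State n) {R : ℝ} (hR : 0 < R) :
    HasSum (fun k : ℕ => (-1) ^ k / (k.factorial * Real.Gamma (k + (n : ℝ) / 2 + 1)) *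
      (Real.pi ^ ((n : ℝ) / 2) * Real.pi ^ (2 * k) * R ^ (n + 2 * k) * ‖x‖ ^ (2 * k)))
      (∫ ξ in Metric.ball (0 : State n) R, Real.cos (2 * Real.pi * inner ℝ ξ x)) := by
  let F : ℕ → State n → ℝ := fun k ξ =>
    (-1) ^ k * (2 * Real.pi * inner ℝ ξ x) ^ (2 * k) / (2 * k).factorial
  have : IsFiniteMeasure (volume.restrict (Metric.ball (0 : State n) R)) :=
    ⟨by simpa using measure_ball_lt_top⟩
  have hb : ∀ k, ∀ ξ ∈ Metric.ball (0 : State n) R,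
      ‖F k ξ‖ ≤ (2 * Real.pi * (R * ‖x‖)) ^ (2 * k) / (2 * k).factorial := fun k ξ hξ => by
    have h1 : |inner ℝ ξ x| ≤ R * ‖x‖ := (abs_real_inner_le_norm ξ x).trans
      (mul_le_mul_of_nonneg_right (by simpa using (mem_ball_zero_iff.1 hξ).le) (norm_nonneg x))
    have h2 : ‖F k ξ‖ = (2 * Real.pi * |inner ℝ ξ x|) ^ (2 * k) / (2 * k).factorial := by
      simp [F, abs_of_pos Real.pi_pos]
    rw [h2]
    have := Real.pi_pos
    gcongr
  have hFi : ∀ k, Integrable (F k) (volume.restrict (Metric.ball (0 : State n) R)) := fun k => by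
    have hc : Continuous (F k) := by fun_prop
    exact Integrable.of_bound hc.aestronglyMeasurable _
      ((ae_restrict_mem Metric.isOpen_ball.measurableSet).mono (hb k))
  have hs : Summable fun k : ℕ => (2 * Real.pi * (R * ‖x‖)) ^ (2 * k) / ((2 * k).factorial : ℝ) :=
    (Real.summable_pow_div_factorial (2 * Real.pi * (R * ‖x‖))).comp_injective
      (i := fun k : ℕ => 2 * k) fun a b h => by simpa using h
  have key := hasSum_integral_of_summable_integral_norm hFi
    (Summable.of_nonneg_of_le (fun k => integral_nonneg fun ξ => norm_nonneg _) (fun k => by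
      refine (setIntegral_mono_on (hFi k).norm (integrable_const _)
        Metric.isOpen_ball.measurableSet (hb k)).trans_eq ?_
      rw [integral_const, smul_eq_mul]) (hs.mul_left _))
  have h1 : ∀ ξ : State n, ∑' k, F k ξ = Real.cos (2 * Real.pi * inner ℝ ξ x) := fun ξ =>
    (Real.hasSum_cos (2 * Real.pi * inner ℝ ξ x)).tsum_eq
  simp only [h1] at key
  refine (congrArg (fun f => HasSum f _) (funext fun k => ?_)).mp key
  have h2 : ∀ ξ : State n, F k ξ =
      (-1) ^ k * (2 * Real.pi) ^ (2 * k) / (2 * k).factorial * inner ℝ ξ x ^ (2 * k) := fun ξ => by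
    simp only [F, mul_pow]
    ring
  simp only [h2, integral_const_mul, setIntegral_ball_inner_even_pow x k hR]
  have h3 : ((2 * k).factorial : ℝ) ≠ 0 := by positivity
  have h4 : (2 * Real.pi) ^ (2 * k) = 4 ^ k * Real.pi ^ (2 * k) := by
    rw [mul_pow, pow_mul]
    norm_num
  rw [h4]
  field_simp

/-- The factor $\|x\|^{-n/2}$ cancels the fractional power in the Bessel series, so both sides have
the same terms; at $x=0$ both are the volume of the ball. -/
theorem rho_eq_integral_cos {R : ℝ} (hR : 0 < R) (x : State n) :
    rho n R x = ∫ ξ in Metric.ball (0 : State n) R, Real.cos (2 * Real.pi * inner ℝ ξ x) := by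
  by_cases hx : x = 0
  · subst hx
    have h := setIntegral_ball_inner_even_pow (0 : State n) 0 hR
    simp only [mul_zero, pow_zero, add_zero, Nat.cast_zero, zero_add, Nat.factorial_zero,
      Nat.cast_one, one_mul, mul_one, div_one] at h
    simp only [inner_zero_right, mul_zero, Real.cos_zero]
    rw [h, rho, if_pos rfl, mul_div_assoc]
  · have hx' : 0 < ‖x‖ := norm_pos_iff.2 hx
    rw [← (hasSum_integral_cos x hR).tsum_eq, rho, if_neg hx, besselJ, ← tsum_mul_left]
    refine tsum_congr fun k => ?_
    rw [mul_left_comm]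
    congr 1
    have h1 : 2 * Real.pi * R * ‖x‖ / 2 = Real.pi * (R * ‖x‖) := by ring
    have h2 : R ^ (n + 2 * k) = R ^ ((n : ℝ) / 2) * R ^ ((n : ℝ) / 2) * R ^ (2 * k) := by
      rw [← Real.rpow_add hR, add_halves, Real.rpow_natCast, pow_add]
    have h3 : ‖x‖ ^ (-((n : ℝ) / 2)) * ‖x‖ ^ ((n : ℝ) / 2) = 1 := by
      rw [← Real.rpow_add hx', neg_add_cancel, Real.rpow_zero]
    have h4 : ∀ a : ℝ, 0 < a →
        a ^ (2 * (k : ℝ) + (n : ℝ) / 2) = a ^ (2 * k) * a ^ ((n : ℝ) / 2) := by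
      intro a ha
      rw [Real.rpow_add ha, ← Real.rpow_natCast]
      push_cast
      rfl
    rw [h1, h4 _ (by positivity), Real.mul_rpow Real.pi_pos.le (by positivity),
      Real.mul_rpow hR.le hx'.le, h2, mul_pow, mul_pow]
    linear_combination (R ^ ((n : ℝ) / 2) * R ^ ((n : ℝ) / 2) * Real.pi ^ (2 * k) *
      R ^ (2 * k) * ‖x‖ ^ (2 * k) * Real.pi ^ ((n : ℝ) / 2)) * h3

/-- The symbol is the indicator of the ball of radius $R$; the real part of its Fourier integral is
the cosine integral. -/
theorem isBandLimited_rho (n : ℕ) {R : ℝ} (hR : 0 < R) : IsBandLimited (rho n R) := by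
  refine ⟨(Metric.ball (0 : State n) R).indicator fun _ => 1,
    ⟨?_, 1, R, fun ξ => ⟨?_, fun h => ?_⟩⟩, ?_⟩
  · exact (aestronglyMeasurable_const (b := (1 : ℂ))).indicator Metric.isOpen_ball.measurableSet
  · exact (norm_indicator_le_norm_self _ _).trans_eq (by simp)
  · exact indicator_of_notMem (by simpa using h.le) _
  · funext x
    have h1 : ∀ ξ : State n, Complex.exp (((-2 * Real.pi * inner ℝ ξ x : ℝ) : ℂ) * Complex.I) •
        (Metric.ball (0 : State n) R).indicator (fun _ => (1 : ℂ)) ξ =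
        (Metric.ball (0 : State n) R).indicator (fun ξ =>
          Complex.exp (((-2 * Real.pi * inner ℝ ξ x : ℝ) : ℂ) * Complex.I)) ξ := fun ξ => by
      by_cases h : ξ ∈ Metric.ball (0 : State n) R
      · rw [indicator_of_mem h, indicator_of_mem h, smul_eq_mul, mul_one]
      · rw [indicator_of_notMem h, indicator_of_notMem h, smul_zero]
    have : IsFiniteMeasure (volume.restrict (Metric.ball (0 : State n) R)) :=
      ⟨by simpa using measure_ball_lt_top⟩
    have hi : Integrable (fun ξ : State n =>
        Complex.exp (((-2 * Real.pi * inner ℝ ξ x : ℝ) : ℂ) * Complex.I))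
        (volume.restrict (Metric.ball (0 : State n) R)) :=
      Integrable.of_bound (by fun_prop : Continuous fun ξ : State n =>
        Complex.exp (((-2 * Real.pi * inner ℝ ξ x : ℝ) : ℂ) * Complex.I)).aestronglyMeasurable 1
        (Eventually.of_forall fun ξ => (Complex.norm_exp_ofReal_mul_I _).le)
    rw [rho_eq_integral_cos hR, Real.fourier_eq']
    simp only [h1]
    rw [integral_indicator Metric.isOpen_ball.measurableSet]
    refine Eq.trans ?_ (integral_re hi)
    refine integral_congr_ae (Eventually.of_forall fun ξ => ?_)
    change _ = (Complex.exp (((-2 * Real.pi * inner ℝ ξ x : ℝ) : ℂ) * Complex.I)).re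
    rw [Complex.exp_ofReal_mul_I_re, ← Real.cos_neg]
    ring_nf

end FPLearning

/-! ### Assembly of the result -/

theorem mainTheorem8 (n m M N : ℕ) (hm : 1 ≤ m) (hM : 2 ≤ M) (hN : 1 ≤ N)
    (T α R Rstar lam : ℝ) (hT : 0 < T) (hα : 0 < α) (hR : 0 < R) (hRstar : 0 < Rstar)
    (hlam : 0 < lam) (X : Fin M → Fin N → FPLearning.State n) :
    -- the cost is well defined and finite: `∂p̂/∂t` and `(L_t)^* p̂` exist in `L²`
    (∃ g, FPLearning.HasWeakDeriv T (FPLearning.timeIndex n)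
      (FPLearning.modelDensity m T R X) g) ∧
    (∀ c ∈ FPLearning.feasibleSet n m T Rstar,
      ∃ q, FPLearning.IsDualGenerator T α c (FPLearning.modelDensity m T R X) q) ∧
    -- a minimizer exists, and is unique up to equality almost everywhere
    ∃ c ∈ FPLearning.feasibleSet n m T Rstar,
      IsMinOn (FPLearning.learningCost m T α lam (FPLearning.modelDensity m T R X))
        (FPLearning.feasibleSet n m T Rstar) c ∧
      ∀ c' ∈ FPLearning.feasibleSet n m T Rstar,
        IsMinOn (FPLearning.learningCost m T α lam (FPLearning.modelDensity m T R X))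
          (FPLearning.feasibleSet n m T Rstar) c' →
        c'.1 =ᵐ[FPLearning.slabMeasure n T] c.1 ∧ c'.2 =ᵐ[FPLearning.slabMeasure n T] c.2 := by
  have hρ := FPLearning.isBandLimited_rho n hR
  have hp := FPLearning.isSeparatedDensity_modelDensity hm hρ T X
  have hg := FPLearning.hasWeakDeriv_modelDensity hm hρ T X
  have hq : ∀ c ∈ FPLearning.feasibleSet n m T Rstar,
      ∃ q, FPLearning.IsDualGenerator T α c (FPLearning.modelDensity m T R X) q := fun c hc =>
    -- Two weak derivatives of the coefficients suffice, and $d(m)\ge 2(m+1)\ge2$.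
    hp.exists_isDualGenerator (r := FPLearning.sobolevExponent n m)
      (by unfold FPLearning.sobolevExponent; omega) α hc.1.1.1 hc.1.1.2
  exact ⟨⟨_, hg⟩, hq, FPLearning.existsUnique_minimizer hlam hp.continuous hg hq⟩
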